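/- Consider a discounted constrained Markov decision process with measurable state space $\mathcal S$ and action space $\mathcal A$, transition kernel $P(s'\mid s,a)$, initial distribution $\rho$, discount factor $\gamma\in(0,1)$, reward $r_0:\mathcal S\times\mathcal A\to[0,1]$ and utilities $r_i:\mathcal S\times\mathcal A\to[-1,1]$, $i=1,\dots,m$. Let $\{\pi_\theta:\theta\in\mathbb R^d\}$ be a family of stationary stochastic policies with densities $\pi_\theta(a\mid s)$ with respect to a reference measure on $\mathcal A$, and let $$V_i^\theta(\rho):=\mathbb E\Big[\sum_{t=0}^\infty\gamma^t r_i(s_t,a_t)\Big],\qquad s_0\sim\rho,\ a_t\sim\pi_\theta(\cdot\mid s_t),\ s_{t+1}\sim P(\cdot\mid s_t,a_t).$$ Given $n\ge 1$ independent trajectories $(s_t^j,a_t^j)_{t=0}^{H-1}$, $j=1,\dots,n$, sampled under $\pi_\theta$ and truncated at horizon $H\ge 0$, put $$\hat V_i^\theta(\rho):=\frac1n\sum_{j=1}^n\sum_{t=0}^{H-1}\gamma^t r_i(s_t^j,a_t^j),\qquad \hat\nabla_\theta V_i^\theta(\rho):=\frac1n\sum_{j=1}^n\sum_{t=0}^{H-1}\sum_{t'=0}^{t}\gamma^t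 r_i(s_t^j,a_t^j)\,\nabla_\theta\log\pi_\theta(a_{t'}^j\mid s_{t'}^j).$$ Let $U\subseteq\mathbb R^d$ be open (for example $U=\mathbb R^d$, or an open set containing the feasible set $\Theta=\{\theta: V_i^\theta(\rho)\ge0,\ i=1,\dots,m\}$) and let $M_g,M_h>0$ be such that, for all $\theta\in U$ and all $(s,a)$, $\pi_\theta(a\mid s)>0$, $\theta\mapsto\log\pi_\theta(a\mid s)$ is twice differentiable, $\|\nabla_\theta\log\pi_\theta(a\mid s)\|\le M_g$ and $\|\nabla_\theta^2\log\pi_\theta(a\mid s)\|\le M_h$. (Norms are the Euclidean norm of vectors and the operator norm of matrices.) Then for every $i\in\{0,\dots,m\}$: 1. $\theta\mapsto V_i^\theta(\rho)$ is differentiable on $U$, and on every set $X\subseteq\mathbb R^d$ whose convex hull is contained in $U$ (in particular on $X=\Theta$ if the convex hull of $\Theta$ is contained in $U$) it is $L$-Lipschitz continuous and $M$-smooth with $L:=\frac{M_g}{(1-\gamma)^2}$ and $M:=\frac{M_g^2+M_h}{(1-\gamma)^2}$; here $f$ is $M$-smooth on $X$ if $f(x)\le f(y)+\langle\nabla f(y),x-y\rangle+\frac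 M2\|x-y\|^2$ for all $x,y\in X$. 2. For every $\theta\in U$, $n\ge1$, $H\ge0$, both estimators are integrable and, with $b^0(H):=\frac{\gamma^H}{1-\gamma}$ and $b^1(H):=\frac{M_g\gamma^H}{1-\gamma}\sqrt{\frac1{1-\gamma}+H}$, $$\big|V_i^\theta(\rho)-\mathbb E[\hat V_i^\theta(\rho)]\big|\le b^0(H),\qquad \big\|\nabla_\theta V_i^\theta(\rho)-\mathbb E[\hat\nabla_\theta V_i^\theta(\rho)]\big\|\le b^1(H).$$ 3. Let $\sigma^0(n):=\frac{\sqrt2}{\sqrt n(1-\gamma)}$ and $\sigma^1(n):=\frac{2\sqrt2M_g}{\sqrt n(1-\gamma)^{3/2}}$. For every $\theta\in U$, $n\ge1$, $H\ge0$ and $\delta\in(0,1)$, $$\mathbb P\Big(\big|\hat V_i^\theta(\rho)-\mathbb E[\hat V_i^\theta(\rho)]\big|\le\sigma^0(n)\sqrt{\ln\tfrac2\delta}\Big)\ge1-\delta,$$ and if moreover $n\ge8\ln\frac{e^{1/4}}{\delta}$, then $$\mathbb P\Big(\big\|\hat\nabla_\theta V_i^\theta(\rho)-\mathbb E[\hat\nabla_\theta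 V_i^\theta(\rho)]\big\|\le\sigma^1(n)\sqrt{\ln\tfrac{e^{1/4}}\delta}\Big)\ge1-\delta.$$ -/

import Mathlib

open MeasureTheory ProbabilityTheory
open scoped ENNReal RealInnerProductSpace

/-- A discounted constrained Markov decision process with `m` constraints on measurable state and
action spaces: `r 0` is the reward, `r 1, …, r m` are the utilities. -/
structure CMDP (S A : Type*) [MeasurableSpace S] [MeasurableSpace A] (m : ℕ) where
  /-- transition kernel `P(s' | s, a)` -/
  P : Kernel (S × A) S
  markov : IsMarkovKernel P
  /-- initial state distribution -/
  ρ : Measure S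
  prob : IsProbabilityMeasure ρ
  /-- reward (index `0`) and utility functions -/
  r : Fin (m + 1) → S × A → ℝ
  measurable_r : ∀ i, Measurable (r i)
  reward_mem : ∀ x, r 0 x ∈ Set.Icc (0 : ℝ) 1
  utility_mem : ∀ i x, r i x ∈ Set.Icc (-1 : ℝ) 1
  /-- discount factor -/
  γ : ℝ
  γ_pos : 0 < γ
  γ_lt_one : γ < 1

/-- A family of stationary stochastic policies `π_θ(a | s)`, `θ ∈ ℝ^d`, given by probability
densities with respect to a reference measure `ν` on the action space (counting measure for
discrete actions, Lebesgue measure for continuous actions). -/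
structure PolicyFamily (S A : Type*) [MeasurableSpace S] [MeasurableSpace A] (d : ℕ)
    (ν : Measure A) where
  /-- `dens θ s a = π_θ(a | s)` -/
  dens : EuclideanSpace ℝ (Fin d) → S → A → ℝ
  measurable_dens : ∀ θ, Measurable (Function.uncurry (dens θ))
  nonneg : ∀ θ s a, 0 ≤ dens θ s a
  lintegral_eq_one : ∀ θ s, ∫⁻ a, ENNReal.ofReal (dens θ s a) ∂ν = 1

attribute [instance] CMDP.markov CMDP.prob

section

variable {S A : Type*} [MeasurableSpace S] [MeasurableSpace A] {m d : ℕ} {ν : Measure A} [SFinite ν]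

namespace PolicyFamily

/-- The policy `π_θ` as a kernel from states to actions. -/
noncomputable def kernel (π : PolicyFamily S A d ν) (θ : EuclideanSpace ℝ (Fin d)) : Kernel S A :=
  Kernel.withDensity (Kernel.const S ν) (fun s a => ENNReal.ofReal (π.dens θ s a))

instance isMarkovKernel_kernel (π : PolicyFamily S A d ν) (θ : EuclideanSpace ℝ (Fin d)) :
    IsMarkovKernel (π.kernel θ) := by
  refine ⟨fun s => ⟨?_⟩⟩
  have h : Measurable (Function.uncurry fun s a => ENNReal.ofReal (π.dens θ s a)) :=
    (π.measurable_dens θ).ennreal_ofReal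
  rw [kernel, Kernel.withDensity_apply' _ h]
  simpa using π.lintegral_eq_one θ s

/-- The score `∇_θ log π_θ(a | s)`. -/
noncomputable def score (π : PolicyFamily S A d ν) (θ : EuclideanSpace ℝ (Fin d)) (s : S) (a : A) :
    EuclideanSpace ℝ (Fin d) :=
  gradient (fun θ' => Real.log (π.dens θ' s a)) θ

/-- The Hessian `∇²_θ log π_θ(a | s)`, as a linear operator (so that its norm is the operator
norm). -/
noncomputable def hessian (π : PolicyFamily S A d ν) (θ : EuclideanSpace ℝ (Fin d)) (s : S)
    (a : A) : EuclideanSpace ℝ (Fin d) →L[ℝ] EuclideanSpace ℝ (Fin d) :=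
  fderiv ℝ (fun θ' => π.score θ' s a) θ

/-- On the parameter set `U`, the function `θ ↦ log π_θ(a | s)` is well defined and twice
differentiable, with gradient bounded by `Mg` and Hessian bounded by `Mh`, for all `s`, `a`. -/
structure BoundedScore (π : PolicyFamily S A d ν) (U : Set (EuclideanSpace ℝ (Fin d)))
    (Mg Mh : ℝ) : Prop where
  pos : ∀ θ ∈ U, ∀ s a, 0 < π.dens θ s a
  differentiableAt_log : ∀ θ ∈ U, ∀ s a,
    DifferentiableAt ℝ (fun θ' => Real.log (π.dens θ' s a)) θ
  differentiableAt_score : ∀ θ ∈ U, ∀ s a, DifferentiableAt ℝ (fun θ' => π.score θ' s a) θ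
  norm_score_le : ∀ θ ∈ U, ∀ s a, ‖π.score θ s a‖ ≤ Mg
  norm_hessian_le : ∀ θ ∈ U, ∀ s a, ‖π.hessian θ s a‖ ≤ Mh

end PolicyFamily

namespace CMDP

/-- One step of the state-action chain: from `(s, a)`, draw `s' ∼ P(· | s, a)`, then
`a' ∼ π_θ(· | s')`. -/
noncomputable def stepKernel (M : CMDP S A m) (π : PolicyFamily S A d ν)
    (θ : EuclideanSpace ℝ (Fin d)) : Kernel (S × A) (S × A) :=
  M.P ⊗ₖ Kernel.prodMkLeft (S × A) (π.kernel θ)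

instance isMarkovKernel_stepKernel (M : CMDP S A m) (π : PolicyFamily S A d ν)
    (θ : EuclideanSpace ℝ (Fin d)) : IsMarkovKernel (M.stepKernel π θ) := by
  unfold stepKernel; infer_instance

/-- The law of the infinite trajectory `(s_0, a_0, s_1, a_1, …)` with `s_0 ∼ ρ`,
`a_t ∼ π_θ(· | s_t)`, `s_{t+1} ∼ P(· | s_t, a_t)`. -/
noncomputable def trajLaw (M : CMDP S A m) (π : PolicyFamily S A d ν)
    (θ : EuclideanSpace ℝ (Fin d)) : Measure (ℕ → S × A) :=
  Kernel.trajMeasure (X := fun _ => S × A) (M.ρ ⊗ₘ π.kernel θ)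
    (fun t => (M.stepKernel π θ).comap
      (fun x : (i : Finset.Iic t) → S × A => x ⟨t, Finset.mem_Iic.2 le_rfl⟩)
      (measurable_pi_apply _))

/-- The law of the trajectory truncated at horizon `H`, i.e. of `(s_t, a_t)_{t < H}`. -/
noncomputable def truncLaw (M : CMDP S A m) (π : PolicyFamily S A d ν)
    (θ : EuclideanSpace ℝ (Fin d)) (H : ℕ) : Measure (Fin H → S × A) :=
  (M.trajLaw π θ).map (fun τ (t : Fin H) => τ t)

/-- The value `V_i^θ(ρ) = 𝔼[∑_{t ≥ 0} γ^t r_i(s_t, a_t)]`. -/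
noncomputable def value (M : CMDP S A m) (π : PolicyFamily S A d ν) (i : Fin (m + 1))
    (θ : EuclideanSpace ℝ (Fin d)) : ℝ :=
  ∫ τ, ∑' t : ℕ, M.γ ^ t * M.r i (τ t) ∂(M.trajLaw π θ)

/-- The Monte Carlo estimator of `V_i^θ(ρ)` from `n` trajectories of horizon `H`. -/
noncomputable def valueEst (M : CMDP S A m) (i : Fin (m + 1)) {n H : ℕ}
    (τ : Fin n → Fin H → S × A) : ℝ :=
  (1 / (n : ℝ)) * ∑ j : Fin n, ∑ t : Fin H, M.γ ^ (t : ℕ) * M.r i (τ j t)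

/-- The GPOMDP estimator of `∇_θ V_i^θ(ρ)` from `n` trajectories of horizon `H`. -/
noncomputable def gradEst (M : CMDP S A m) (π : PolicyFamily S A d ν) (i : Fin (m + 1))
    (θ : EuclideanSpace ℝ (Fin d)) {n H : ℕ} (τ : Fin n → Fin H → S × A) :
    EuclideanSpace ℝ (Fin d) :=
  (1 / (n : ℝ)) • ∑ j : Fin n, ∑ t : Fin H, ∑ t' ∈ Finset.Iic t,
    (M.γ ^ (t : ℕ) * M.r i (τ j t)) • π.score θ (τ j t').1 (τ j t').2

end CMDP

end

/-- `f` is `L`-Lipschitz continuous on `X`. -/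
def LipschitzContOn {d : ℕ} (f : EuclideanSpace ℝ (Fin d) → ℝ) (L : ℝ)
    (X : Set (EuclideanSpace ℝ (Fin d))) : Prop :=
  ∀ x ∈ X, ∀ y ∈ X, |f x - f y| ≤ L * ‖x - y‖

/-- `f` is `M`-smooth on `X`: `f x ≤ f y + ⟨∇f(y), x - y⟩ + (M / 2) ‖x - y‖²` on `X`. -/
def MSmoothOn {d : ℕ} (f : EuclideanSpace ℝ (Fin d) → ℝ) (M : ℝ)
    (X : Set (EuclideanSpace ℝ (Fin d))) : Prop :=
  ∀ x ∈ X, ∀ y ∈ X, f x ≤ f y + ⟪gradient f y, x - y⟫ + M / 2 * ‖x - y‖ ^ 2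

/-- Bias bound of the value estimator. -/
noncomputable def biasValue (γ : ℝ) (H : ℕ) : ℝ := γ ^ H / (1 - γ)

/-- Bias bound of the gradient estimator. -/
noncomputable def biasGrad (γ Mg : ℝ) (H : ℕ) : ℝ :=
  Mg * γ ^ H / (1 - γ) * √(1 / (1 - γ) + H)

/-- Sub-Gaussian scale of the value estimator. -/
noncomputable def scaleValue (γ : ℝ) (n : ℕ) : ℝ := √2 / (√n * (1 - γ))

/-- Sub-Gaussian scale of the gradient estimator. -/
noncomputable def scaleGrad (γ Mg : ℝ) (n : ℕ) : ℝ :=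
  2 * √2 * Mg / (√n * (1 - γ) ^ (3 / 2 : ℝ))

/-! Write S_t for the accumulated score, the sum of ∇ log π_θ(a_k | s_k) over k ≤ t.

Change of measure. Functions of the history up to t have, under θ', the same integral as under θ
after weighting by exp(`logLik` θ' - `logLik` θ): initial law and transitions do not depend on the
parameter and cancel. On a small ball this weight is bounded, so differentiation under the integral
gives the policy gradient ∇E[r(s_t, a_t)] = E[r S_t] (`hasGradientAt_expReward`), and a second
differentiation gives the curvature.

Martingale structure. Differentiating "total mass 1" shows that the score has mean zero from every
state, so S_t is a martingale with increments at most Mg. Hence E⟨S_t, u⟩² ≤ (t+1) Mg² ‖u‖² and E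
cosh(c‖S_t‖) ≤ cosh(c Mg)^(t+1). The first bound gives ‖∇E r_t‖ ≤ Mg √(t+1) and second derivatives
at most (t+1)(Mg² + Mh) along unit vectors. Since ∑ γ^t (t+1) = 1/(1-γ)², the smoothness constant
follows; the Lipschitz constant only needs the cruder bound Mg (t+1).

Bias. The estimators have expectation the partial sums of the series for the value and its gradient,
so the bias is a tail. For the gradient the tail ∑_{t ≥ H} γ^t √(t+1) is bounded by concavity of the
square root, replacing it by its tangent at the mean 1/(1-γ) + H of t+1 under the normalized
geometric tail.

Concentration. The value estimator is a mean of bounded variables: Hoeffding. For one trajectory's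
gradient estimator X, Jensen applied to cosh with weights proportional to γ^t √(t+1) gives E
cosh(c‖X‖) ≤ exp(c²σ²/2) with σ = Mg/(1-γ)^(3/2), with no dependence on dimension or horizon. A
Hilbert space inequality for cosh‖z + y‖, linear in y up to norms, transfers this to sums of
centered independent copies. Chebyshev covers moderate δ and a Chernoff bound with cosh the small δ;
together they yield the constant e^(1/4) (`measureReal_norm_sum_sub_integral_le`). -/

set_option linter.unusedSectionVars false

/-! ### Hyperbolic cosine of a norm in an inner product space -/

section Cosh

/-- As a function of x², cosh is a power series with nonnegative coefficients, so it is convex in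
x²; the convexity is checked term by term. -/
lemma Real.cosh_le_of_sq_eq {w p q a b : ℝ} (ha : 0 ≤ a) (hb : 0 ≤ b) (hab : a + b = 1)
    (h : w ^ 2 = a * p ^ 2 + b * q ^ 2) :
    Real.cosh w ≤ a * Real.cosh p + b * Real.cosh q := by
  refine hasSum_le (fun n => ?_) (Real.hasSum_cosh w)
    (((Real.hasSum_cosh p).mul_left a).add ((Real.hasSum_cosh q).mul_left b))
  have hc := (convexOn_pow (𝕜 := ℝ) n).2 (Set.mem_Ici.2 (sq_nonneg p))
    (Set.mem_Ici.2 (sq_nonneg q)) ha hb hab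
  simp only [smul_eq_mul] at hc
  rw [pow_mul, pow_mul, pow_mul, h, ← mul_div_assoc, ← mul_div_assoc, ← add_div]
  gcongr

variable {E : Type*} [NormedAddCommGroup E] [InnerProductSpace ℝ E]

/-- The quantity ‖z‖² + b² + 2⟪z, y⟫ dominates ‖z + y‖² and is a convex combination of (‖z‖ + b)²
and (‖z‖ - b)²; convexity of cosh in the square then applies. The bound is affine in y, so for a
centered random y only the product of cosh's survives integration. -/
lemma Real.cosh_norm_add_le (z : E) {y : E} {b : ℝ} (hy : ‖y‖ ≤ b) :
    Real.cosh ‖z + y‖ ≤ Real.cosh ‖z‖ * Real.cosh b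
      + ⟪z, y⟫ * (Real.sinh ‖z‖ / ‖z‖) * (Real.sinh b / b) := by
  have hb : 0 ≤ b := (norm_nonneg y).trans hy
  rcases eq_or_ne z 0 with rfl | hz
  · simpa [abs_of_nonneg hb] using hy
  rcases hb.eq_or_lt with rfl | hb
  · have : y = 0 := norm_le_zero_iff.1 hy
    simp [this]
  have hu : 0 < ‖z‖ := norm_pos_iff.2 hz
  have hub : 0 < ‖z‖ * b := mul_pos hu hb
  have hin : |⟪z, y⟫| ≤ ‖z‖ * b :=
    (abs_real_inner_le_norm z y).trans (by gcongr)
  -- The cosine-like parameter s ∈ [-1, 1] fixes the weights (1 ± s)/2 of the two extreme cases ‖z‖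
  -- ± b.
  set s : ℝ := ⟪z, y⟫ / (‖z‖ * b) with hs
  have hs1 : |s| ≤ 1 := by
    rw [hs, abs_div, abs_of_pos hub, div_le_one hub]; exact hin
  have hzy : ⟪z, y⟫ = s * (‖z‖ * b) := by rw [hs]; field_simp
  obtain ⟨h1, h2⟩ := abs_le.1 hs1
  have hw : 0 ≤ ‖z‖ ^ 2 + b ^ 2 + 2 * ⟪z, y⟫ := by
    rw [hzy]
    nlinarith [sq_nonneg (‖z‖ - b), mul_nonneg hub.le (by linarith : (0 : ℝ) ≤ 1 + s)]
  have hle : ‖z + y‖ ≤ √(‖z‖ ^ 2 + b ^ 2 + 2 * ⟪z, y⟫) := by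
    apply Real.le_sqrt_of_sq_le
    rw [norm_add_sq_real]
    have : ‖y‖ ^ 2 ≤ b ^ 2 := by gcongr
    linarith
  have key := Real.cosh_le_of_sq_eq (w := √(‖z‖ ^ 2 + b ^ 2 + 2 * ⟪z, y⟫)) (p := ‖z‖ + b)
    (q := ‖z‖ - b) (a := (1 + s) / 2) (b := (1 - s) / 2) (by linarith) (by linarith) (by ring)
    (by rw [Real.sq_sqrt hw, hzy]; ring)
  calc Real.cosh ‖z + y‖ ≤ Real.cosh √(‖z‖ ^ 2 + b ^ 2 + 2 * ⟪z, y⟫) := by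
        rw [Real.cosh_le_cosh, abs_of_nonneg (norm_nonneg _), abs_of_nonneg (Real.sqrt_nonneg _)]
        exact hle
    _ ≤ _ := key
    _ = _ := by
        rw [Real.cosh_add, Real.cosh_sub, hs]
        field_simp
        ring

end Cosh

/-! ### Measurability of gradients and differentiation under the integral -/

section Gradient

variable {d : ℕ} {T : Type*} [MeasurableSpace T]

/-- Each coordinate of the gradient is a pointwise limit of difference quotients along a sequence of
steps smaller than ε, and these quotients are measurable. -/
lemma measurable_of_hasGradientAt {f : EuclideanSpace ℝ (Fin d) → T → ℝ}
    {S : T → EuclideanSpace ℝ (Fin d)} {θ : EuclideanSpace ℝ (Fin d)} {ε : ℝ} (hε : 0 < ε)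
    (hf : ∀ θ' ∈ Metric.ball θ ε, Measurable (f θ'))
    (hS : ∀ x, HasGradientAt (fun θ' => f θ' x) (S x) θ) : Measurable S := by
  suffices h : ∀ i, Measurable fun x => S x i by
    have := (MeasurableEquiv.toLp 2 (Fin d → ℝ)).measurable.comp (measurable_pi_iff.2 h)
    exact this
  intro i
  let e : EuclideanSpace ℝ (Fin d) := EuclideanSpace.single i 1
  let c : ℕ → ℝ := fun n => ε / (n + 2)
  have hc0 : ∀ n, 0 < c n := fun n => by positivity
  have hcε : ∀ n, c n < ε := fun n => by
    rw [div_lt_iff₀ (by positivity)]; nlinarith [Nat.cast_nonneg (α := ℝ) n]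
  have hc : Filter.Tendsto c Filter.atTop (nhdsWithin 0 {0}ᶜ) := by
    refine tendsto_nhdsWithin_iff.2 ⟨?_, Filter.Eventually.of_forall fun n => (hc0 n).ne'⟩
    exact tendsto_const_nhds.div_atTop
      (Filter.tendsto_atTop_add_const_right _ _ tendsto_natCast_atTop_atTop)
  refine measurable_of_tendsto_metrizable
    (f := fun n x => slope (fun t : ℝ => f (θ + t • e) x) 0 (c n)) (fun n => ?_)
    (tendsto_pi_nhds.2 fun x => ?_)
  · simp only [slope_def_field]
    refine ((hf _ ?_).sub (hf _ ?_)).div_const _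
    · rw [mem_ball_iff_norm, add_sub_cancel_left, norm_smul, Real.norm_of_nonneg (hc0 n).le]
      simpa [e] using hcε n
    · simpa using hε
  · refine HasDerivAt.tendsto_slope ?_ |>.comp hc
    have h1 : HasFDerivAt (fun θ' => f θ' x) (InnerProductSpace.toDual ℝ _ (S x))
        (θ + (0 : ℝ) • e) := by simpa using (hS x).hasFDerivAt
    have h2 : HasDerivAt (fun t : ℝ => θ + t • e) e 0 := by
      simpa using ((hasDerivAt_id (0 : ℝ)).smul_const e).const_add θ
    have h3 := h1.comp_hasDerivAt (0 : ℝ) h2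
    simpa [e, EuclideanSpace.inner_single_right, Function.comp_def] using h3

/-- Dominated differentiation: the mean value inequality bounds l θ' - l θ by B ε on the ball, so
the weight is at most exp(B ε) and the integrand's derivative has a constant bound. At θ itself the
weight is 1, which is why it is absent from the resulting gradient. -/
lemma hasGradientAt_integral_exp_mul {μ : Measure T} [IsProbabilityMeasure μ]
    {l g : EuclideanSpace ℝ (Fin d) → T → ℝ}
    {S g' : EuclideanSpace ℝ (Fin d) → T → EuclideanSpace ℝ (Fin d)}
    {θ : EuclideanSpace ℝ (Fin d)} {ε B C C' : ℝ} (hε : 0 < ε)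
    (hl_meas : ∀ θ' ∈ Metric.ball θ ε, Measurable (l θ'))
    (hg_meas : ∀ θ' ∈ Metric.ball θ ε, Measurable (g θ'))
    (hl : ∀ θ' ∈ Metric.ball θ ε, ∀ x, HasGradientAt (fun η => l η x) (S θ' x) θ')
    (hg : ∀ θ' ∈ Metric.ball θ ε, ∀ x, HasGradientAt (fun η => g η x) (g' θ' x) θ')
    (hS_le : ∀ θ' ∈ Metric.ball θ ε, ∀ x, ‖S θ' x‖ ≤ B)
    (hg_le : ∀ θ' ∈ Metric.ball θ ε, ∀ x, |g θ' x| ≤ C)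
    (hg'_le : ∀ θ' ∈ Metric.ball θ ε, ∀ x, ‖g' θ' x‖ ≤ C') :
    HasGradientAt (fun θ' => ∫ x, Real.exp (l θ' x - l θ x) * g θ' x ∂μ)
      (∫ x, (g θ x • S θ x + g' θ x) ∂μ) θ := by
  have hθ : θ ∈ Metric.ball θ ε := Metric.mem_ball_self hε
  obtain ⟨x₀⟩ : Nonempty T := nonempty_of_isProbabilityMeasure μ
  have hB : 0 ≤ B := (norm_nonneg _).trans (hS_le θ hθ x₀)
  have hC : 0 ≤ C := (abs_nonneg _).trans (hg_le θ hθ x₀)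
  have hS_meas : Measurable (S θ) := measurable_of_hasGradientAt hε hl_meas (hl θ hθ)
  have hg'_meas : Measurable (g' θ) := measurable_of_hasGradientAt hε hg_meas (hg θ hθ)
  have hlip : ∀ θ' ∈ Metric.ball θ ε, ∀ x, |l θ' x - l θ x| ≤ B * ε := by
    intro θ' hθ' x
    have := (convex_ball θ ε).norm_image_sub_le_of_norm_hasFDerivWithin_le (𝕜 := ℝ)
      (f := fun η => l η x) (C := B)
      (fun η hη => ((hl η hη x).hasFDerivAt).hasFDerivWithinAt)
      (fun η hη => by simpa using hS_le η hη x) hθ hθ'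
    rw [Real.norm_eq_abs] at this
    refine this.trans (mul_le_mul_of_nonneg_left ?_ hB)
    rw [← dist_eq_norm]; exact (Metric.mem_ball.1 hθ').le
  let F' : EuclideanSpace ℝ (Fin d) → T → EuclideanSpace ℝ (Fin d) →L[ℝ] ℝ := fun θ' x =>
    InnerProductSpace.toDual ℝ _ (Real.exp (l θ' x - l θ x) • (g θ' x • S θ' x + g' θ' x))
  have hbd : ∀ θ' ∈ Metric.ball θ ε, ∀ x, ‖g θ' x • S θ' x + g' θ' x‖ ≤ C * B + C' := by
    intro θ' hθ' x
    refine (norm_add_le _ _).trans (add_le_add ?_ (hg'_le θ' hθ' x))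
    rw [norm_smul, Real.norm_eq_abs]
    exact mul_le_mul (hg_le θ' hθ' x) (hS_le θ' hθ' x) (norm_nonneg _) hC
  have hint : Integrable (fun x => g θ x • S θ x + g' θ x) μ :=
    Integrable.of_bound (((hg_meas θ hθ).smul hS_meas).add hg'_meas).aestronglyMeasurable
      (C * B + C') (Filter.Eventually.of_forall (hbd θ hθ))
  have key := hasFDerivAt_integral_of_dominated_of_fderiv_le (𝕜 := ℝ) (μ := μ)
    (F := fun θ' x => Real.exp (l θ' x - l θ x) * g θ' x) (F' := F') (x₀ := θ)
    (bound := fun _ => Real.exp (B * ε) * (C * B + C')) (Metric.ball_mem_nhds θ hε)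
    (by
      filter_upwards [Metric.ball_mem_nhds θ hε] with θ' hθ'
      exact ((((hl_meas θ' hθ').sub (hl_meas θ hθ)).exp).mul (hg_meas θ' hθ')).aestronglyMeasurable)
    (by
      refine Integrable.of_bound ?_ C (Filter.Eventually.of_forall fun x => ?_)
      · exact ((((hl_meas θ hθ).sub (hl_meas θ hθ)).exp).mul (hg_meas θ hθ)).aestronglyMeasurable
      · simpa using hg_le θ hθ x)
    (by
      refine (InnerProductSpace.toDual ℝ (EuclideanSpace ℝ (Fin d))).continuous.comp_aestronglyMeasurable ?_
      simpa using hint.aestronglyMeasurable)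
    (Filter.Eventually.of_forall fun x θ' hθ' => by
      simp only [F', LinearIsometryEquiv.norm_map, norm_smul, Real.norm_eq_abs, Real.abs_exp]
      refine mul_le_mul ?_ (hbd θ' hθ' x) (norm_nonneg _) (Real.exp_pos _).le
      exact Real.exp_le_exp.2 ((le_abs_self _).trans (hlip θ' hθ' x)))
    (integrable_const _)
    (Filter.Eventually.of_forall fun x θ' hθ' => by
      have h1 := (((hl θ' hθ' x).hasFDerivAt).sub_const (l θ x)).exp
      have h2 := h1.mul (hg θ' hθ' x).hasFDerivAt
      refine h2.congr_fderiv ?_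
      ext v
      simp only [F', add_apply, smul_apply, InnerProductSpace.toDual_apply_apply, inner_smul_left, inner_add_left, smul_eq_mul]
      simp
      ring)
  refine key.congr_fderiv ?_
  ext v
  have hF' : ∀ x, F' θ x = InnerProductSpace.toDual ℝ _ (g θ x • S θ x + g' θ x) := by
    intro x; simp [F']
  simp only [hF']
  rw [ContinuousLinearMap.integral_apply, InnerProductSpace.toDual_apply_apply,
    real_inner_comm, ← integral_inner hint]
  · simp_rw [InnerProductSpace.toDual_apply_apply, real_inner_comm]
  · exact (LinearIsometryEquiv.integrable_comp_iff _).2 hint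

end Gradient

/-! ### Trajectory law and one-step conditioning -/

section Trajectory

variable {X : Type*} [MeasurableSpace X]

/-- The trajectory that follows `p.1` up to time `t` and stays at `p.2` afterwards. -/
def extendHistory (t : ℕ) (p : ((_ : Finset.Iic t) → X) × X) : ℕ → X := fun k =>
  if h : k ≤ t then p.1 ⟨k, Finset.mem_Iic.2 h⟩ else p.2

lemma measurable_extendHistory (t : ℕ) : Measurable (extendHistory (X := X) t) := by
  refine measurable_pi_iff.2 fun k => ?_
  by_cases h : k ≤ t
  · simp only [extendHistory, h, dite_true]; fun_prop
  · simp only [extendHistory, h, dite_false]; fun_prop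

lemma DependsOn.extendHistory_eq {β : Type*} {F : (ℕ → X) → β} {t : ℕ}
    (hF : DependsOn F (Set.Iic (t + 1))) (τ : ℕ → X) (x : X) :
    F (extendHistory t (Preorder.frestrictLe t τ, x)) = F (Function.update τ (t + 1) x) := by
  apply hF
  intro k hk
  have hk' : k ≤ t + 1 := hk
  rcases hk'.lt_or_eq with h | rfl
  · have : k ≤ t := by omega
    simp [extendHistory, this, Function.update_of_ne h.ne]
  · simp [extendHistory]

lemma DependsOn.extendHistory_eq_self {β : Type*} {F : (ℕ → X) → β} {t : ℕ}
    (hF : DependsOn F (Set.Iic (t + 1))) (τ : ℕ → X) :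
    F (extendHistory t (Preorder.frestrictLe t τ, τ (t + 1))) = F τ := by
  rw [hF.extendHistory_eq]; simp

lemma map_eval_zero_trajMeasure (μ₀ : Measure X) [IsProbabilityMeasure μ₀]
    (κ : (t : ℕ) → Kernel ((_ : Finset.Iic t) → X) X) [∀ t, IsMarkovKernel (κ t)] :
    (Kernel.trajMeasure (X := fun _ => X) μ₀ κ).map (fun τ => τ 0) = μ₀ := by
  have h : (fun τ : ℕ → X => τ 0) =
      (fun x : (_ : Finset.Iic 0) → X => x ⟨0, Finset.mem_Iic.2 le_rfl⟩) ∘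
        (Preorder.frestrictLe (π := fun _ => X) 0) := rfl
  rw [h, ← Measure.map_map (by fun_prop) (by fun_prop), Kernel.trajMeasure,
    Measure.map_comp _ _ (by fun_prop), Kernel.traj_map_frestrictLe, Kernel.partialTraj_self,
    Measure.id_comp, Measure.map_map (by fun_prop) (by fun_prop)]
  exact Measure.map_id

end Trajectory

section

variable {S A : Type*} [MeasurableSpace S] [MeasurableSpace A] {m d : ℕ} {ν : Measure A} [SFinite ν]

namespace CMDP

variable (M : CMDP S A m) (π : PolicyFamily S A d ν) (θ : EuclideanSpace ℝ (Fin d))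

instance : IsProbabilityMeasure (M.trajLaw π θ) := by
  unfold trajLaw; infer_instance

lemma stepKernel_apply (x : S × A) : M.stepKernel π θ x = M.P x ⊗ₘ π.kernel θ := by
  ext s hs
  rw [stepKernel, Kernel.compProd_apply hs, Measure.compProd_apply hs]
  rfl

lemma map_eval_zero_trajLaw : (M.trajLaw π θ).map (fun τ => τ 0) = M.ρ ⊗ₘ π.kernel θ :=
  map_eval_zero_trajMeasure _ _

lemma map_trajLaw_succ (t : ℕ) :
    (M.trajLaw π θ).map (fun τ => (Preorder.frestrictLe (π := fun _ => S × A) t τ, τ (t + 1))) =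
    (M.trajLaw π θ).map (Preorder.frestrictLe (π := fun _ => S × A) t) ⊗ₘ
      ((M.stepKernel π θ).comap
        (fun x : (_ : Finset.Iic t) → S × A => x ⟨t, Finset.mem_Iic.2 le_rfl⟩)
        (measurable_pi_apply _)) :=
  Kernel.map_frestrictLe_trajMeasure_compProd_eq_map_trajMeasure.symm

/-- The Markov property in integrated form: resampling the coordinate t + 1 from the step kernel
does not change the law of the history up to t + 1. It drives all the inductions on time. -/
lemma lintegral_trajLaw_succ {t : ℕ} {F : (ℕ → S × A) → ℝ≥0∞} (hF : Measurable F)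
    (hFt : DependsOn F (Set.Iic (t + 1))) :
    ∫⁻ τ, F τ ∂M.trajLaw π θ =
      ∫⁻ τ, ∫⁻ x, F (Function.update τ (t + 1) x) ∂M.stepKernel π θ (τ t) ∂M.trajLaw π θ := by
  have hm := hF.comp (measurable_extendHistory t)
  calc ∫⁻ τ, F τ ∂M.trajLaw π θ
      = ∫⁻ p, (F ∘ extendHistory t) p ∂(M.trajLaw π θ).map
          (fun τ => (Preorder.frestrictLe (π := fun _ => S × A) t τ, τ (t + 1))) := by
        rw [lintegral_map hm (by fun_prop)]
        simp_rw [Function.comp_apply, hFt.extendHistory_eq_self]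
    _ = _ := by
        rw [map_trajLaw_succ, Measure.lintegral_compProd hm,
          lintegral_map hm.lintegral_kernel_prod_right' (by fun_prop)]
        simp_rw [Function.comp_apply, hFt.extendHistory_eq]
        rfl

lemma integral_trajLaw_succ {t : ℕ} {F : (ℕ → S × A) → ℝ} {C : ℝ} (hF : Measurable F)
    (hFC : ∀ τ, |F τ| ≤ C) (hFt : DependsOn F (Set.Iic (t + 1))) :
    ∫ τ, F τ ∂M.trajLaw π θ =
      ∫ τ, ∫ x, F (Function.update τ (t + 1) x) ∂M.stepKernel π θ (τ t) ∂M.trajLaw π θ := by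
  have hm := hF.comp (measurable_extendHistory t)
  have hmap : Measurable fun τ : ℕ → S × A =>
    (Preorder.frestrictLe (π := fun _ => S × A) t τ, τ (t + 1)) := by fun_prop
  have hprob := Measure.isProbabilityMeasure_map (μ := M.trajLaw π θ) hmap.aemeasurable
  have hint : Integrable (F ∘ extendHistory t) ((M.trajLaw π θ).map
      (fun τ => (Preorder.frestrictLe (π := fun _ => S × A) t τ, τ (t + 1)))) :=
    Integrable.of_bound hm.aestronglyMeasurable C (Filter.Eventually.of_forall fun p => hFC _)
  calc ∫ τ, F τ ∂M.trajLaw π θ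
      = ∫ p, (F ∘ extendHistory t) p ∂(M.trajLaw π θ).map
          (fun τ => (Preorder.frestrictLe (π := fun _ => S × A) t τ, τ (t + 1))) := by
        rw [integral_map hmap.aemeasurable hint.1]
        simp_rw [Function.comp_apply, hFt.extendHistory_eq_self]
    _ = _ := by
        rw [map_trajLaw_succ] at hint ⊢
        rw [Measure.integral_compProd hint, integral_map (by fun_prop)]
        · simp_rw [Function.comp_apply, hFt.extendHistory_eq]
          rfl
        · exact (hm.stronglyMeasurable.integral_kernel_prod_right').aestronglyMeasurable

end CMDP

/-! ### Likelihood ratios between two policies -/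

namespace PolicyFamily

variable (π : PolicyFamily S A d ν)

/-- `log π_θ(a | s)` as a function of the pair `(s, a)`. -/
noncomputable def logDens (θ : EuclideanSpace ℝ (Fin d)) (x : S × A) : ℝ :=
  Real.log (π.dens θ x.1 x.2)

/-- The log-likelihood of the actions up to time `t`. -/
noncomputable def logLik (θ : EuclideanSpace ℝ (Fin d)) (t : ℕ) (τ : ℕ → S × A) : ℝ :=
  ∑ k ∈ Finset.range (t + 1), π.logDens θ (τ k)

lemma measurable_logDens (θ : EuclideanSpace ℝ (Fin d)) : Measurable (π.logDens θ) :=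
  (π.measurable_dens θ).log

lemma measurable_logLik (θ : EuclideanSpace ℝ (Fin d)) (t : ℕ) : Measurable (π.logLik θ t) :=
  Finset.measurable_fun_sum _ fun k _ => (π.measurable_logDens θ).comp (measurable_pi_apply k)

lemma measurable_ofReal_exp_logDens_sub (θ θ' : EuclideanSpace ℝ (Fin d)) :
    Measurable fun x => ENNReal.ofReal (Real.exp (π.logDens θ' x - π.logDens θ x)) :=
  (((π.measurable_logDens θ').sub (π.measurable_logDens θ)).exp).ennreal_ofReal

lemma measurable_ofReal_exp_logLik_sub (θ θ' : EuclideanSpace ℝ (Fin d)) (t : ℕ) :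
    Measurable fun τ => ENNReal.ofReal (Real.exp (π.logLik θ' t τ - π.logLik θ t τ)) :=
  (((π.measurable_logLik θ' t).sub (π.measurable_logLik θ t)).exp).ennreal_ofReal

lemma lintegral_kernel_eq {θ θ' : EuclideanSpace ℝ (Fin d)} {s : S}
    (hθ : ∀ a, 0 < π.dens θ s a) (hθ' : ∀ a, 0 < π.dens θ' s a) {f : A → ℝ≥0∞}
    (hf : Measurable f) :
    ∫⁻ a, f a ∂π.kernel θ' s =
      ∫⁻ a, f a * ENNReal.ofReal (Real.exp (π.logDens θ' (s, a) - π.logDens θ (s, a)))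
        ∂π.kernel θ s := by
  have hm : ∀ η, Measurable (Function.uncurry fun s a => ENNReal.ofReal (π.dens η s a)) :=
    fun η => (π.measurable_dens η).ennreal_ofReal
  have hw : Measurable fun a => ENNReal.ofReal
      (Real.exp (π.logDens θ' (s, a) - π.logDens θ (s, a))) :=
    (π.measurable_ofReal_exp_logDens_sub θ θ').comp measurable_prodMk_left
  have hfw : Measurable fun a => f a * ENNReal.ofReal
      (Real.exp (π.logDens θ' (s, a) - π.logDens θ (s, a))) := hf.mul hw
  rw [kernel, kernel, Kernel.lintegral_withDensity _ (hm θ') _ hf,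
    Kernel.lintegral_withDensity _ (hm θ) _ hfw]
  refine lintegral_congr fun a => ?_
  have h1 := hθ a
  have h2 : π.dens θ' s a = π.dens θ s a *
      Real.exp (π.logDens θ' (s, a) - π.logDens θ (s, a)) := by
    simp only [logDens]
    rw [Real.exp_sub, Real.exp_log (hθ' a), Real.exp_log h1]
    field_simp
  rw [h2, ENNReal.ofReal_mul h1.le]
  ring

lemma lintegral_compProd_kernel_eq {U : Set (EuclideanSpace ℝ (Fin d))}
    (hU : ∀ θ ∈ U, ∀ s a, 0 < π.dens θ s a) {θ θ' : EuclideanSpace ℝ (Fin d)} (hθ : θ ∈ U)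
    (hθ' : θ' ∈ U) (μ : Measure S) [SFinite μ] {f : S × A → ℝ≥0∞} (hf : Measurable f) :
    ∫⁻ x, f x ∂(μ ⊗ₘ π.kernel θ') =
      ∫⁻ x, f x * ENNReal.ofReal (Real.exp (π.logDens θ' x - π.logDens θ x))
        ∂(μ ⊗ₘ π.kernel θ) := by
  have hfw : Measurable fun x => f x * ENNReal.ofReal
      (Real.exp (π.logDens θ' x - π.logDens θ x)) :=
    hf.mul (π.measurable_ofReal_exp_logDens_sub θ θ')
  rw [Measure.lintegral_compProd hf, Measure.lintegral_compProd hfw]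
  exact lintegral_congr fun s => π.lintegral_kernel_eq (hU θ hθ s) (hU θ' hθ' s)
    (hf.comp measurable_prodMk_left)

end PolicyFamily

namespace CMDP

variable (M : CMDP S A m) (π : PolicyFamily S A d ν)

lemma logLik_update_succ (θ : EuclideanSpace ℝ (Fin d)) (t : ℕ) (τ : ℕ → S × A) (x : S × A) :
    π.logLik θ (t + 1) (Function.update τ (t + 1) x) = π.logLik θ t τ + π.logDens θ x := by
  rw [PolicyFamily.logLik, Finset.sum_range_succ, Function.update_self, PolicyFamily.logLik]
  congr 1
  refine Finset.sum_congr rfl fun k hk => ?_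
  rw [Function.update_of_ne (Finset.mem_range.1 hk).ne]

lemma dependsOn_logLik (θ : EuclideanSpace ℝ (Fin d)) (t : ℕ) :
    DependsOn (π.logLik θ t) (Set.Iic t) := fun τ τ' h =>
  Finset.sum_congr rfl fun k hk => by
    rw [h k (Set.mem_Iic.2 (Nat.lt_succ_iff.1 (Finset.mem_range.1 hk)))]

lemma dependsOn_lintegral_update {t : ℕ} {F : (ℕ → S × A) → ℝ≥0∞}
    (hFt : DependsOn F (Set.Iic (t + 1))) (κ : Kernel (S × A) (S × A)) :
    DependsOn (fun τ : ℕ → S × A => ∫⁻ x, F (Function.update τ (t + 1) x) ∂κ (τ t))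
      (Set.Iic t) := by
  intro τ τ' h
  simp only
  rw [h t (Set.mem_Iic.2 le_rfl)]
  refine lintegral_congr fun x => hFt fun k hk => ?_
  rcases (Set.mem_Iic.1 hk).lt_or_eq with hk | rfl
  · rw [Function.update_of_ne hk.ne, Function.update_of_ne hk.ne]
    exact h k (Set.mem_Iic.2 (by omega))
  · simp

lemma measurable_lintegral_update {t : ℕ} {F : (ℕ → S × A) → ℝ≥0∞} (hF : Measurable F)
    (κ : Kernel (S × A) (S × A)) [IsSFiniteKernel κ] :
    Measurable fun τ : ℕ → S × A => ∫⁻ x, F (Function.update τ (t + 1) x) ∂κ (τ t) := by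
  have h : Measurable fun p : (ℕ → S × A) × (S × A) => F (Function.update p.1 (t + 1) p.2) :=
    hF.comp measurable_update'
  exact h.lintegral_kernel_prod_right' (κ := κ.comap (fun τ : ℕ → S × A => τ t) (by fun_prop))

/-- Induction on t: conditioning on the history up to t splits off the last coordinate, whose law
changes by a single density ratio because P is common to both policies. The ratios multiply to the
exponential of the difference of log-likelihoods. -/
lemma lintegral_trajLaw_eq {U : Set (EuclideanSpace ℝ (Fin d))}
    (hU : ∀ θ ∈ U, ∀ s a, 0 < π.dens θ s a) {θ θ' : EuclideanSpace ℝ (Fin d)} (hθ : θ ∈ U)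
    (hθ' : θ' ∈ U) (t : ℕ) {F : (ℕ → S × A) → ℝ≥0∞} (hF : Measurable F)
    (hFt : DependsOn F (Set.Iic t)) :
    ∫⁻ τ, F τ ∂M.trajLaw π θ' =
      ∫⁻ τ, F τ * ENNReal.ofReal (Real.exp (π.logLik θ' t τ - π.logLik θ t τ))
        ∂M.trajLaw π θ := by
  induction t generalizing F with
  | zero =>
    have hF0 : ∀ τ, F τ = F (fun _ => τ 0) := fun τ => hFt fun k hk => by
      rw [Nat.le_zero.1 hk]
    have hm : Measurable fun x : S × A => F fun _ => x :=
      hF.comp (measurable_pi_iff.2 fun _ => measurable_id)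
    have h1 : ∀ G : S × A → ℝ≥0∞, Measurable G → ∀ η,
        ∫⁻ τ, G (τ 0) ∂M.trajLaw π η = ∫⁻ x, G x ∂(M.ρ ⊗ₘ π.kernel η) := fun G hG η => by
      rw [← map_eval_zero_trajLaw, lintegral_map hG (by fun_prop)]
    have h2 := h1 _ (hm.mul (π.measurable_ofReal_exp_logDens_sub θ θ')) θ
    simp_rw [hF0]
    rw [h1 _ hm, π.lintegral_compProd_kernel_eq hU hθ hθ' _ hm]
    simp only [PolicyFamily.logLik, zero_add, Finset.range_one,
      Finset.sum_singleton]
    exact h2.symm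
  | succ t ih =>
    have hFw : Measurable fun τ => F τ * ENNReal.ofReal
        (Real.exp (π.logLik θ' (t + 1) τ - π.logLik θ (t + 1) τ)) :=
      hF.mul (π.measurable_ofReal_exp_logLik_sub θ θ' (t + 1))
    rw [M.lintegral_trajLaw_succ π θ' hF hFt,
      ih (measurable_lintegral_update hF _) (dependsOn_lintegral_update hFt _),
      M.lintegral_trajLaw_succ π θ (t := t) hFw]
    · refine lintegral_congr fun τ => ?_
      have hmu : Measurable fun x => F (Function.update τ (t + 1) x) :=
        hF.comp (measurable_update τ)
      simp_rw [stepKernel_apply, logLik_update_succ]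
      rw [π.lintegral_compProd_kernel_eq hU hθ hθ' _ hmu, ← lintegral_mul_const'']
      · refine lintegral_congr fun x => ?_
        rw [mul_assoc, ← ENNReal.ofReal_mul (Real.exp_pos _).le, ← Real.exp_add]
        congr 3
        ring
      · exact (hmu.mul (π.measurable_ofReal_exp_logDens_sub θ θ')).aemeasurable
    · intro τ τ' h
      simp only
      rw [hFt h, dependsOn_logLik π θ' _ h, dependsOn_logLik π θ _ h]

lemma integral_trajLaw_eq {U : Set (EuclideanSpace ℝ (Fin d))}
    (hU : ∀ θ ∈ U, ∀ s a, 0 < π.dens θ s a) {θ θ' : EuclideanSpace ℝ (Fin d)} (hθ : θ ∈ U)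
    (hθ' : θ' ∈ U) (t : ℕ) {F : (ℕ → S × A) → ℝ} (hF : Measurable F)
    (hFt : DependsOn F (Set.Iic t)) :
    ∫ τ, F τ ∂M.trajLaw π θ' =
      ∫ τ, Real.exp (π.logLik θ' t τ - π.logLik θ t τ) * F τ ∂M.trajLaw π θ := by
  obtain ⟨τ₀⟩ : Nonempty (ℕ → S × A) := nonempty_of_isProbabilityMeasure (M.trajLaw π θ)
  let W : (ℕ → S × A) → ℝ≥0∞ := fun τ =>
    ENNReal.ofReal (Real.exp (π.logLik θ' t τ - π.logLik θ t τ))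
  have hW : Measurable W := π.measurable_ofReal_exp_logLik_sub θ θ' t
  let R := Preorder.frestrictLe (π := fun _ : ℕ => S × A) t
  have hR : Measurable R := Preorder.measurable_frestrictLe t
  -- The infinite trajectory laws need not be absolutely continuous; only their restrictions to
  -- histories up to t are compared. Equality of these measures gives the Bochner identity without
  -- any integrability assumption on F.
  have hmap : (M.trajLaw π θ').map R = ((M.trajLaw π θ).withDensity W).map R := by
    ext s hs
    have hs' := hR hs
    rw [Measure.map_apply hR hs, Measure.map_apply hR hs, withDensity_apply _ hs',
      ← lintegral_indicator_one hs', ← lintegral_indicator hs',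
      M.lintegral_trajLaw_eq π hU hθ hθ' t (measurable_one.indicator hs')]
    · refine lintegral_congr fun τ => ?_
      by_cases h : τ ∈ R ⁻¹' s <;> simp [h, W]
    · intro τ τ' h
      have : R τ = R τ' := by ext k : 1; exact h k (Set.mem_Iic.2 (Finset.mem_Iic.1 k.2))
      have hiff : τ ∈ R ⁻¹' s ↔ τ' ∈ R ⁻¹' s := by rw [Set.mem_preimage, Set.mem_preimage, this]
      by_cases hτ : τ ∈ R ⁻¹' s
      · rw [Set.indicator_of_mem hτ, Set.indicator_of_mem (hiff.1 hτ)]; rfl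
      · rw [Set.indicator_of_notMem hτ, Set.indicator_of_notMem (mt hiff.2 hτ)]
  -- The filler `τ₀ 0` after time t is irrelevant, since F only depends on coordinates up to t.
  let G : ((_ : Finset.Iic t) → S × A) → ℝ := fun h => F (extendHistory t (h, τ₀ 0))
  have hG : Measurable G :=
    hF.comp ((measurable_extendHistory t).comp (measurable_id.prodMk measurable_const))
  have hGF : ∀ τ, G (R τ) = F τ := fun τ => hFt fun k hk => by
    simp [extendHistory, R, Set.mem_Iic.1 hk]
  calc ∫ τ, F τ ∂M.trajLaw π θ' = ∫ h, G h ∂(M.trajLaw π θ').map R := by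
        rw [integral_map hR.aemeasurable hG.aestronglyMeasurable]; simp_rw [hGF]
    _ = ∫ τ, F τ ∂(M.trajLaw π θ).withDensity W := by
        rw [hmap, integral_map hR.aemeasurable hG.aestronglyMeasurable]; simp_rw [hGF]
    _ = _ := by
        rw [integral_withDensity_eq_integral_toReal_smul hW
          (Filter.Eventually.of_forall fun _ => ENNReal.ofReal_lt_top)]
        simp [W, ENNReal.toReal_ofReal (Real.exp_pos _).le]

end CMDP

end

/-! ### The accumulated score as a bounded-increment martingale -/

section

variable {S A : Type*} [MeasurableSpace S] [MeasurableSpace A] {m d : ℕ} {ν : Measure A} [SFinite ν]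

namespace PolicyFamily

/-- The accumulated score `∑_{k ≤ t} ∇_θ log π_θ(a_k | s_k)`. -/
noncomputable def scoreSum (π : PolicyFamily S A d ν) (θ : EuclideanSpace ℝ (Fin d)) (t : ℕ)
    (τ : ℕ → S × A) : EuclideanSpace ℝ (Fin d) :=
  ∑ k ∈ Finset.range (t + 1), π.score θ (τ k).1 (τ k).2

lemma scoreSum_update_succ (π : PolicyFamily S A d ν) (θ : EuclideanSpace ℝ (Fin d)) (t : ℕ)
    (τ : ℕ → S × A) (x : S × A) :
    π.scoreSum θ (t + 1) (Function.update τ (t + 1) x) =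
      π.scoreSum θ t τ + π.score θ x.1 x.2 := by
  rw [scoreSum, Finset.sum_range_succ, Function.update_self, scoreSum]
  congr 1
  refine Finset.sum_congr rfl fun k hk => ?_
  rw [Function.update_of_ne (Finset.mem_range.1 hk).ne]

lemma dependsOn_scoreSum (π : PolicyFamily S A d ν) (θ : EuclideanSpace ℝ (Fin d)) (t : ℕ) :
    DependsOn (π.scoreSum θ t) (Set.Iic t) := fun τ τ' h =>
  Finset.sum_congr rfl fun k hk => by
    rw [h k (Set.mem_Iic.2 (Nat.lt_succ_iff.1 (Finset.mem_range.1 hk)))]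

lemma scoreSum_zero (π : PolicyFamily S A d ν) (θ : EuclideanSpace ℝ (Fin d)) (τ : ℕ → S × A) :
    π.scoreSum θ 0 τ = π.score θ (τ 0).1 (τ 0).2 := by simp [scoreSum]

end PolicyFamily

lemma HasGradientAt.finset_sum {E ι : Type*} [NormedAddCommGroup E] [InnerProductSpace ℝ E]
    [CompleteSpace E] {s : Finset ι} {f : ι → E → ℝ} {f' : ι → E} {x : E}
    (h : ∀ i ∈ s, HasGradientAt (f i) (f' i) x) :
    HasGradientAt (fun y => ∑ i ∈ s, f i y) (∑ i ∈ s, f' i) x := by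
  rw [hasGradientAt_iff_hasFDerivAt, map_sum]
  exact HasFDerivAt.fun_sum fun i hi => (h i hi).hasFDerivAt

namespace PolicyFamily.BoundedScore

variable {π : PolicyFamily S A d ν} {U : Set (EuclideanSpace ℝ (Fin d))} {Mg Mh : ℝ}
  {θ : EuclideanSpace ℝ (Fin d)}

lemma hasGradientAt_logDens (hπ : π.BoundedScore U Mg Mh) (hθ : θ ∈ U) (x : S × A) :
    HasGradientAt (fun η => π.logDens η x) (π.score θ x.1 x.2) θ :=
  (hπ.differentiableAt_log θ hθ x.1 x.2).hasGradientAt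

lemma measurable_score (hπ : π.BoundedScore U Mg Mh) (hU : IsOpen U) (hθ : θ ∈ U) :
    Measurable fun x : S × A => π.score θ x.1 x.2 := by
  obtain ⟨ε, hε, -⟩ := Metric.isOpen_iff.1 hU θ hθ
  exact measurable_of_hasGradientAt hε (fun η _ => π.measurable_logDens η)
    (hπ.hasGradientAt_logDens hθ)

lemma measurable_scoreSum (hπ : π.BoundedScore U Mg Mh) (hU : IsOpen U) (hθ : θ ∈ U) (t : ℕ) :
    Measurable (π.scoreSum θ t) :=
  Finset.measurable_fun_sum _ fun k _ => (hπ.measurable_score hU hθ).comp (measurable_pi_apply k)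

lemma hasGradientAt_logLik (hπ : π.BoundedScore U Mg Mh) (hθ : θ ∈ U) (t : ℕ) (τ : ℕ → S × A) :
    HasGradientAt (fun η => π.logLik η t τ) (π.scoreSum θ t τ) θ :=
  HasGradientAt.finset_sum fun k _ => hπ.hasGradientAt_logDens hθ (τ k)

lemma norm_scoreSum_le (hπ : π.BoundedScore U Mg Mh) (hθ : θ ∈ U) (t : ℕ) (τ : ℕ → S × A) :
    ‖π.scoreSum θ t τ‖ ≤ (t + 1) * Mg := by
  refine (norm_sum_le_of_le _ fun k _ => hπ.norm_score_le θ hθ _ _).trans ?_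
  simp

/-- The likelihood ratio integrates to 1 for all nearby parameters, so its gradient at θ vanishes;
by differentiation under the integral with g = 1 that gradient is the mean score. -/
lemma integral_score_kernel (hπ : π.BoundedScore U Mg Mh) (hU : IsOpen U) (hθ : θ ∈ U) (s : S) :
    ∫ a, π.score θ s a ∂π.kernel θ s = 0 := by
  obtain ⟨ε, hε, hball⟩ := Metric.isOpen_iff.1 hU θ hθ
  have h := hasGradientAt_integral_exp_mul (μ := π.kernel θ s) (θ := θ) (ε := ε)
    (l := fun η a => π.logDens η (s, a)) (g := fun _ _ => 1) (S := fun η a => π.score η s a)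
    (g' := fun _ _ => 0) (B := Mg) (C := 1) (C' := 0) hε
    (fun η _ => (π.measurable_logDens η).comp measurable_prodMk_left)
    (fun _ _ => measurable_const) (fun η hη a => hπ.hasGradientAt_logDens (hball hη) (s, a))
    (fun η _ a => hasGradientAt_const η 1) (fun η hη a => hπ.norm_score_le η (hball hη) s a)
    (fun _ _ _ => by simp) (fun _ _ _ => by simp)
  have h1 : ∀ η ∈ Metric.ball θ ε,
      ∫ a, Real.exp (π.logDens η (s, a) - π.logDens θ (s, a)) * 1 ∂π.kernel θ s = 1 := by
    intro η hη
    have h2 := π.lintegral_kernel_eq (s := s) (hπ.pos θ hθ s) (hπ.pos η (hball hη) s)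
      (measurable_const (a := (1 : ℝ≥0∞)))
    simp only [lintegral_const, measure_univ, one_mul] at h2
    simp only [mul_one]
    rw [integral_eq_lintegral_of_nonneg_ae (Filter.Eventually.of_forall fun _ => (Real.exp_pos _).le),
      ← h2, ENNReal.toReal_one]
    exact ((((π.measurable_logDens η).sub (π.measurable_logDens θ)).exp).comp
      measurable_prodMk_left).aestronglyMeasurable
  have h3 : HasGradientAt (fun η => ∫ a, Real.exp (π.logDens η (s, a) - π.logDens θ (s, a)) * 1
      ∂π.kernel θ s) 0 θ := by
    refine (hasGradientAt_const θ (1 : ℝ)).congr_of_eventuallyEq ?_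
    filter_upwards [Metric.ball_mem_nhds θ hε] with η hη using h1 η hη
  have h4 := h.unique h3
  simpa using h4

lemma integrable_score (hπ : π.BoundedScore U Mg Mh) (hU : IsOpen U) (hθ : θ ∈ U)
    (μ : Measure (S × A)) [IsFiniteMeasure μ] :
    Integrable (fun x : S × A => π.score θ x.1 x.2) μ :=
  Integrable.of_bound (hπ.measurable_score hU hθ).aestronglyMeasurable Mg
    (Filter.Eventually.of_forall fun x => hπ.norm_score_le θ hθ x.1 x.2)

lemma integral_score_compProd (hπ : π.BoundedScore U Mg Mh) (hU : IsOpen U) (hθ : θ ∈ U)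
    (μ : Measure S) [IsProbabilityMeasure μ] :
    ∫ x, π.score θ x.1 x.2 ∂(μ ⊗ₘ π.kernel θ) = 0 := by
  rw [Measure.integral_compProd (hπ.integrable_score hU hθ _)]
  simp [hπ.integral_score_kernel hU hθ]

end PolicyFamily.BoundedScore

section CenteredVectors

variable {E T : Type*} [NormedAddCommGroup E] [InnerProductSpace ℝ E] [CompleteSpace E]
  [MeasurableSpace T] {μ : Measure T} [IsProbabilityMeasure μ] {Y : T → E} {b : ℝ}

lemma integral_cosh_norm_add_le (hY : AEStronglyMeasurable Y μ) (hYb : ∀ x, ‖Y x‖ ≤ b)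
    (h0 : ∫ x, Y x ∂μ = 0) (z : E) :
    ∫ x, Real.cosh ‖z + Y x‖ ∂μ ≤ Real.cosh ‖z‖ * Real.cosh b := by
  have hint : Integrable Y μ := Integrable.of_bound hY b (Filter.Eventually.of_forall hYb)
  have hin : Integrable (fun x => ⟪z, Y x⟫) μ := hint.const_inner z
  have hmeas : AEStronglyMeasurable (fun x => Real.cosh ‖z + Y x‖) μ :=
    Real.continuous_cosh.comp_aestronglyMeasurable (hY.const_add z).norm
  have hR : Integrable (fun x => Real.cosh ‖z‖ * Real.cosh b
      + ⟪z, Y x⟫ * (Real.sinh ‖z‖ / ‖z‖) * (Real.sinh b / b)) μ :=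
    (integrable_const _).add ((hin.mul_const _).mul_const _)
  have hL : Integrable (fun x => Real.cosh ‖z + Y x‖) μ := by
    refine hR.mono' hmeas (Filter.Eventually.of_forall fun x => ?_)
    rw [Real.norm_of_nonneg (Real.cosh_pos _).le]
    exact Real.cosh_norm_add_le z (hYb x)
  calc ∫ x, Real.cosh ‖z + Y x‖ ∂μ
      ≤ ∫ x, (Real.cosh ‖z‖ * Real.cosh b
          + ⟪z, Y x⟫ * (Real.sinh ‖z‖ / ‖z‖) * (Real.sinh b / b)) ∂μ :=
        integral_mono hL hR fun x => Real.cosh_norm_add_le z (hYb x)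
    _ = _ := by
        rw [integral_add (integrable_const _) ((hin.mul_const _).mul_const _),
          integral_mul_const (Real.sinh b / b),
          integral_mul_const (Real.sinh ‖z‖ / ‖z‖), integral_inner hint, h0]
        simp

lemma integral_add_sq_le {f : T → ℝ} (hf : AEStronglyMeasurable f μ) (hfb : ∀ x, |f x| ≤ b)
    (h0 : ∫ x, f x ∂μ = 0) (c : ℝ) : ∫ x, (c + f x) ^ 2 ∂μ ≤ c ^ 2 + b ^ 2 := by
  have hint : Integrable f μ := Integrable.of_bound hf b (Filter.Eventually.of_forall hfb)
  have hR : Integrable (fun x => c ^ 2 + b ^ 2 + 2 * c * f x) μ :=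
    (integrable_const _).add (hint.const_mul _)
  have hle : ∀ x, (c + f x) ^ 2 ≤ c ^ 2 + b ^ 2 + 2 * c * f x := fun x => by
    have := sq_le_sq' (abs_le.1 (hfb x)).1 (abs_le.1 (hfb x)).2
    nlinarith
  have hL : Integrable (fun x => (c + f x) ^ 2) μ := by
    refine hR.mono' ((hf.const_add c).pow 2) (Filter.Eventually.of_forall fun x => ?_)
    rw [Real.norm_of_nonneg (sq_nonneg _)]
    exact hle x
  refine (integral_mono hL hR hle).trans_eq ?_
  rw [integral_add (integrable_const _) (hint.const_mul _), integral_const_mul, h0]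
  simp

end CenteredVectors

namespace CMDP

variable (M : CMDP S A m) {π : PolicyFamily S A d ν} {U : Set (EuclideanSpace ℝ (Fin d))}
  {Mg Mh : ℝ} {θ : EuclideanSpace ℝ (Fin d)}

/-- Martingale increments are orthogonal: conditionally on the past the cross term vanishes and each
step adds at most (Mg ‖u‖)². This yields growth t + 1 where the pointwise bound would give (t + 1)².
-/
lemma integral_sq_inner_scoreSum_le (hπ : π.BoundedScore U Mg Mh) (hU : IsOpen U) (hθ : θ ∈ U)
    (u : EuclideanSpace ℝ (Fin d)) (t : ℕ) :
    ∫ τ, ⟪π.scoreSum θ t τ, u⟫ ^ 2 ∂M.trajLaw π θ ≤ (t + 1) * (Mg * ‖u‖) ^ 2 := by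
  have hstep : ∀ (μ : Measure S) [IsProbabilityMeasure μ] (c : ℝ),
      ∫ x, (c + ⟪π.score θ x.1 x.2, u⟫) ^ 2 ∂(μ ⊗ₘ π.kernel θ) ≤ c ^ 2 + (Mg * ‖u‖) ^ 2 := by
    intro μ _ c
    refine integral_add_sq_le ((hπ.measurable_score hU hθ).inner_const).aestronglyMeasurable
      (fun x => ?_) ?_ c
    · refine (abs_real_inner_le_norm _ _).trans ?_
      gcongr
      exact hπ.norm_score_le θ hθ _ _
    · simp_rw [real_inner_comm u]
      rw [integral_inner (hπ.integrable_score hU hθ _), hπ.integral_score_compProd hU hθ]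
      simp
  have hm : ∀ t, Measurable fun τ => ⟪π.scoreSum θ t τ, u⟫ ^ 2 := fun t =>
    ((hπ.measurable_scoreSum hU hθ t).inner_const).pow_const 2
  have hb : ∀ t τ, |⟪π.scoreSum θ t τ, u⟫ ^ 2| ≤ ((t + 1) * Mg * ‖u‖) ^ 2 := fun t τ => by
    rw [abs_pow]
    gcongr
    refine (abs_real_inner_le_norm _ _).trans ?_
    gcongr
    exact hπ.norm_scoreSum_le hθ t τ
  induction t with
  | zero =>
    have h := hstep M.ρ 0
    rw [← map_eval_zero_trajLaw, integral_map (measurable_pi_apply 0).aemeasurable] at h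
    · simpa [PolicyFamily.scoreSum_zero] using h
    · exact (((hπ.measurable_score hU hθ).inner_const.const_add 0).pow_const 2).aestronglyMeasurable
  | succ t ih =>
    rw [M.integral_trajLaw_succ π θ (t := t) (hm _) (hb _)
      (fun τ τ' h => by simp only [π.dependsOn_scoreSum θ _ h])]
    simp_rw [PolicyFamily.scoreSum_update_succ, inner_add_left, stepKernel_apply]
    have hint : Integrable (fun τ => ⟪π.scoreSum θ t τ, u⟫ ^ 2 + (Mg * ‖u‖) ^ 2)
        (M.trajLaw π θ) :=
      (Integrable.of_bound (hm t).aestronglyMeasurable _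
        (Filter.Eventually.of_forall (hb t))).add (integrable_const _)
    refine (integral_mono_of_nonneg (Filter.Eventually.of_forall fun τ =>
      integral_nonneg fun x => sq_nonneg _) hint
      (Filter.Eventually.of_forall fun τ => hstep _ _)).trans ?_
    rw [integral_add (Integrable.of_bound (hm t).aestronglyMeasurable _
        (Filter.Eventually.of_forall (hb t))) (integrable_const _)]
    simp only [integral_const, probReal_univ, one_smul]
    push_cast
    linarith

/-- Each step multiplies the conditional expectation by at most cosh(c Mg), by
`integral_cosh_norm_add_le` applied to the centered increment c times the score. -/
lemma integral_cosh_scoreSum_le (hπ : π.BoundedScore U Mg Mh) (hU : IsOpen U) (hθ : θ ∈ U)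
    {c : ℝ} (hc : 0 ≤ c) (t : ℕ) :
    ∫ τ, Real.cosh (c * ‖π.scoreSum θ t τ‖) ∂M.trajLaw π θ ≤ Real.cosh (c * Mg) ^ (t + 1) := by
  have hn : ∀ z : EuclideanSpace ℝ (Fin d), c * ‖z‖ = ‖c • z‖ := fun z => by
    rw [norm_smul, Real.norm_of_nonneg hc]
  have hstep : ∀ (μ : Measure S) [IsProbabilityMeasure μ] (z : EuclideanSpace ℝ (Fin d)),
      ∫ x, Real.cosh (c * ‖z + π.score θ x.1 x.2‖) ∂(μ ⊗ₘ π.kernel θ) ≤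
        Real.cosh (c * ‖z‖) * Real.cosh (c * Mg) := by
    intro μ _ z
    simp_rw [hn, smul_add]
    refine integral_cosh_norm_add_le (Y := fun x : S × A => c • π.score θ x.1 x.2)
      ((hπ.measurable_score hU hθ).const_smul c).aestronglyMeasurable (fun x => ?_) ?_ (c • z)
    · rw [← hn]
      gcongr
      exact hπ.norm_score_le θ hθ _ _
    · rw [integral_smul, hπ.integral_score_compProd hU hθ, smul_zero]
  have hm : ∀ t, Measurable fun τ => Real.cosh (c * ‖π.scoreSum θ t τ‖) := fun t =>
    Real.measurable_cosh.comp ((hπ.measurable_scoreSum hU hθ t).norm.const_mul c)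
  have hb : ∀ t τ, |Real.cosh (c * ‖π.scoreSum θ t τ‖)| ≤ Real.cosh (c * ((t + 1) * Mg)) :=
    fun t τ => by
      have h := hπ.norm_scoreSum_le hθ t τ
      rw [abs_of_pos (Real.cosh_pos _), Real.cosh_le_cosh, abs_of_nonneg (by positivity),
        abs_of_nonneg (mul_nonneg hc ((norm_nonneg _).trans h))]
      gcongr
  have hI : ∀ t, Integrable (fun τ => Real.cosh (c * ‖π.scoreSum θ t τ‖)) (M.trajLaw π θ) :=
    fun t => Integrable.of_bound (hm t).aestronglyMeasurable _
      (Filter.Eventually.of_forall (hb t))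
  induction t with
  | zero =>
    have h := hstep M.ρ 0
    rw [← map_eval_zero_trajLaw, integral_map (measurable_pi_apply 0).aemeasurable] at h
    · simpa [PolicyFamily.scoreSum_zero] using h
    · exact (Real.measurable_cosh.comp
        (((hπ.measurable_score hU hθ).const_add 0).norm.const_mul c)).aestronglyMeasurable
  | succ t ih =>
    rw [M.integral_trajLaw_succ π θ (t := t) (hm _) (hb _)
      (fun τ τ' h => by simp only [π.dependsOn_scoreSum θ _ h])]
    simp_rw [PolicyFamily.scoreSum_update_succ, stepKernel_apply]
    refine (integral_mono_of_nonneg (Filter.Eventually.of_forall fun τ =>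
      integral_nonneg fun x => (Real.cosh_pos _).le) ((hI t).mul_const (Real.cosh (c * Mg)))
      (Filter.Eventually.of_forall fun τ => hstep _ _)).trans ?_
    rw [integral_mul_const, pow_succ _ (t + 1)]
    exact mul_le_mul_of_nonneg_right ih (Real.cosh_pos _).le

end CMDP

end

/-! ### Policy gradient, Lipschitz continuity and smoothness of the value -/

lemma hasSum_geometric_mul_succ {γ : ℝ} (h0 : 0 ≤ γ) (h1 : γ < 1) :
    HasSum (fun t : ℕ => γ ^ t * ((t : ℝ) + 1)) (1 / (1 - γ) ^ 2) := by
  have h := (hasSum_coe_mul_geometric_of_norm_lt_one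
    (by rwa [Real.norm_of_nonneg h0] : ‖γ‖ < 1)).add (hasSum_geometric_of_lt_one h0 h1)
  have h2 : 1 - γ ≠ 0 := by linarith
  have h3 : 1 / (1 - γ) ^ 2 = γ / (1 - γ) ^ 2 + (1 - γ)⁻¹ := by field_simp; ring
  have h4 : (fun t : ℕ => γ ^ t * ((t : ℝ) + 1)) = fun t : ℕ => (t : ℝ) * γ ^ t + γ ^ t := by
    ext t; ring
  rw [h3, h4]
  exact h

/-- Two monotonicity arguments: f' s - K s is antitone, hence so is f s - f'(0) s - K s²/2. Neither
continuity nor a lower bound of f'' is required. -/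
lemma le_taylor_of_second_deriv_le {f f' f'' : ℝ → ℝ} {K : ℝ}
    (hf : ∀ s ∈ Set.Icc (0 : ℝ) 1, HasDerivAt f (f' s) s)
    (hf' : ∀ s ∈ Set.Icc (0 : ℝ) 1, HasDerivAt f' (f'' s) s)
    (hK : ∀ s ∈ Set.Icc (0 : ℝ) 1, f'' s ≤ K) : f 1 ≤ f 0 + f' 0 + K / 2 := by
  have hsub := interior_subset (s := Set.Icc (0 : ℝ) 1)
  have h0 : (0 : ℝ) ∈ Set.Icc (0 : ℝ) 1 := by simp
  have h1 : (1 : ℝ) ∈ Set.Icc (0 : ℝ) 1 := by simp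
  have hd1 : ∀ s ∈ Set.Icc (0 : ℝ) 1, HasDerivAt (fun s => f' s - K * s) (f'' s - K) s :=
    fun s hs => by simpa using (hf' s hs).fun_sub ((hasDerivAt_id s).const_mul K)
  have ha1 : AntitoneOn (fun s => f' s - K * s) (Set.Icc 0 1) :=
    antitoneOn_of_hasDerivWithinAt_nonpos (convex_Icc 0 1)
      (fun s hs => (hd1 s hs).continuousAt.continuousWithinAt)
      (fun s hs => (hd1 s (hsub hs)).hasDerivWithinAt)
      (fun s hs => by linarith [hK s (hsub hs)])
  have hd2 : ∀ s ∈ Set.Icc (0 : ℝ) 1,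
      HasDerivAt (fun s => f s - f' 0 * s - K / 2 * s ^ 2) (f' s - f' 0 - K * s) s :=
    fun s hs => by
      have h := ((hf s hs).fun_sub ((hasDerivAt_id s).const_mul (f' 0))).fun_sub
        (((hasDerivAt_id s).fun_pow 2).const_mul (K / 2))
      refine h.congr_deriv ?_
      simp; ring
  have ha2 : AntitoneOn (fun s => f s - f' 0 * s - K / 2 * s ^ 2) (Set.Icc 0 1) :=
    antitoneOn_of_hasDerivWithinAt_nonpos (convex_Icc 0 1)
      (fun s hs => (hd2 s hs).continuousAt.continuousWithinAt)
      (fun s hs => (hd2 s (hsub hs)).hasDerivWithinAt)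
      (fun s hs => by
        have := ha1 h0 (hsub hs) (hsub hs).1
        simp only at this
        linarith)
  have := ha2 h0 h1 zero_le_one
  simp only at this
  linarith

section

variable {S A : Type*} [MeasurableSpace S] [MeasurableSpace A] {m d : ℕ} {ν : Measure A} [SFinite ν]

namespace CMDP

variable (M : CMDP S A m) (π : PolicyFamily S A d ν)

lemma abs_r_le (i : Fin (m + 1)) (x : S × A) : |M.r i x| ≤ 1 := by
  rw [abs_le]; exact M.utility_mem i x

/-- The expected reward `𝔼[r_i(s_t, a_t)]` at time `t`. -/
noncomputable def expReward (i : Fin (m + 1)) (t : ℕ) (θ : EuclideanSpace ℝ (Fin d)) : ℝ :=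
  ∫ τ, M.r i (τ t) ∂M.trajLaw π θ

/-- The policy gradient `𝔼[r_i(s_t, a_t) ∑_{k ≤ t} ∇_θ log π_θ(a_k | s_k)]` of the expected reward
at time `t`. -/
noncomputable def rewardGrad (i : Fin (m + 1)) (t : ℕ) (θ : EuclideanSpace ℝ (Fin d)) :
    EuclideanSpace ℝ (Fin d) :=
  ∫ τ, M.r i (τ t) • π.scoreSum θ t τ ∂M.trajLaw π θ

lemma measurable_r_eval (i : Fin (m + 1)) (t : ℕ) :
    Measurable fun τ : ℕ → S × A => M.r i (τ t) :=
  (M.measurable_r i).comp (measurable_pi_apply t)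

lemma dependsOn_r_eval (i : Fin (m + 1)) (t : ℕ) :
    DependsOn (fun τ : ℕ → S × A => M.r i (τ t)) (Set.Iic t) := fun τ τ' h => by
  simp only [h t (Set.mem_Iic.2 le_rfl)]

lemma value_eq_tsum (i : Fin (m + 1)) (θ : EuclideanSpace ℝ (Fin d)) :
    HasSum (fun t => M.γ ^ t * M.expReward π i t θ) (M.value π i θ) := by
  have hg := hasSum_geometric_of_lt_one M.γ_pos.le M.γ_lt_one
  have hle : ∀ t (τ : ℕ → S × A), ‖M.γ ^ t * M.r i (τ t)‖ ≤ M.γ ^ t := fun t τ => by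
    rw [norm_mul, Real.norm_of_nonneg (pow_nonneg M.γ_pos.le t)]
    exact mul_le_of_le_one_right (pow_nonneg M.γ_pos.le t) (M.abs_r_le i _)
  have hint : ∀ t, Integrable (fun τ : ℕ → S × A => M.γ ^ t * M.r i (τ t)) (M.trajLaw π θ) :=
    fun t => Integrable.of_bound ((M.measurable_r_eval i t).const_mul _).aestronglyMeasurable _
      (Filter.Eventually.of_forall (hle t))
  have h := hasSum_integral_of_summable_integral_norm hint
    (Summable.of_nonneg_of_le (fun t => integral_nonneg fun τ => norm_nonneg _)
      (fun t => by
        refine (integral_mono_of_nonneg (Filter.Eventually.of_forall fun τ => norm_nonneg _)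
          (integrable_const (M.γ ^ t)) (Filter.Eventually.of_forall (hle t))).trans_eq ?_
        simp) hg.summable)
  simp only [integral_const_mul] at h
  exact h

variable {π} {U : Set (EuclideanSpace ℝ (Fin d))} {Mg Mh : ℝ} {θ : EuclideanSpace ℝ (Fin d)}

/-- Near θ the integral is rewritten under the fixed law at θ by `integral_trajLaw_eq`, which
reduces to differentiation under the integral with `logLik` as exponent. -/
lemma hasGradientAt_integral_trajLaw (hπ : π.BoundedScore U Mg Mh) (hU : IsOpen U) (hθ : θ ∈ U)
    (t : ℕ) {g : EuclideanSpace ℝ (Fin d) → (ℕ → S × A) → ℝ}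
    {g' : EuclideanSpace ℝ (Fin d) → (ℕ → S × A) → EuclideanSpace ℝ (Fin d)} {C C' : ℝ}
    (hg_meas : ∀ η ∈ U, Measurable (g η)) (hg_dep : ∀ η ∈ U, DependsOn (g η) (Set.Iic t))
    (hg : ∀ η ∈ U, ∀ τ, HasGradientAt (fun η => g η τ) (g' η τ) η)
    (hg_le : ∀ η ∈ U, ∀ τ, |g η τ| ≤ C) (hg'_le : ∀ η ∈ U, ∀ τ, ‖g' η τ‖ ≤ C') :
    HasGradientAt (fun η => ∫ τ, g η τ ∂M.trajLaw π η)
      (∫ τ, (g θ τ • π.scoreSum θ t τ + g' θ τ) ∂M.trajLaw π θ) θ := by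
  obtain ⟨ε, hε, hball⟩ := Metric.isOpen_iff.1 hU θ hθ
  refine (hasGradientAt_integral_exp_mul (μ := M.trajLaw π θ) (l := fun η => π.logLik η t)
    (S := fun η => π.scoreSum η t) (B := (t + 1) * Mg) hε
    (fun η _ => π.measurable_logLik η t) (fun η hη => hg_meas η (hball hη))
    (fun η hη τ => hπ.hasGradientAt_logLik (hball hη) t τ) (fun η hη => hg η (hball hη))
    (fun η hη τ => hπ.norm_scoreSum_le (hball hη) t τ) (fun η hη => hg_le η (hball hη))
    (fun η hη => hg'_le η (hball hη))).congr_of_eventuallyEq ?_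
  filter_upwards [Metric.ball_mem_nhds θ hε] with η hη
  exact M.integral_trajLaw_eq π hπ.pos hθ (hball hη) t (hg_meas η (hball hη))
    (hg_dep η (hball hη))

lemma hasGradientAt_expReward (hπ : π.BoundedScore U Mg Mh) (hU : IsOpen U) (hθ : θ ∈ U)
    (i : Fin (m + 1)) (t : ℕ) :
    HasGradientAt (M.expReward π i t) (M.rewardGrad π i t θ) θ := by
  have h := M.hasGradientAt_integral_trajLaw hπ hU hθ t (g := fun _ τ => M.r i (τ t))
    (g' := fun _ _ => 0) (C := 1) (C' := 0) (fun _ _ => M.measurable_r_eval i t)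
    (fun _ _ => M.dependsOn_r_eval i t) (fun η _ τ => hasGradientAt_const η _)
    (fun _ _ τ => M.abs_r_le i _) (fun _ _ _ => by simp)
  simp only [add_zero] at h
  exact h

lemma integrable_r_smul_scoreSum (hπ : π.BoundedScore U Mg Mh) (hU : IsOpen U) (hθ : θ ∈ U)
    (i : Fin (m + 1)) (t : ℕ) :
    Integrable (fun τ => M.r i (τ t) • π.scoreSum θ t τ) (M.trajLaw π θ) := by
  refine Integrable.of_bound
    ((M.measurable_r_eval i t).smul (hπ.measurable_scoreSum hU hθ t)).aestronglyMeasurable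
    ((t + 1) * Mg) (Filter.Eventually.of_forall fun τ => ?_)
  rw [norm_smul]
  exact (mul_le_of_le_one_left (norm_nonneg _) (M.abs_r_le i _)).trans
    (hπ.norm_scoreSum_le hθ t τ)

lemma integrable_sq_inner_scoreSum (hπ : π.BoundedScore U Mg Mh) (hU : IsOpen U) (hθ : θ ∈ U)
    (u : EuclideanSpace ℝ (Fin d)) (t : ℕ) :
    Integrable (fun τ => ⟪π.scoreSum θ t τ, u⟫ ^ 2) (M.trajLaw π θ) := by
  refine Integrable.of_bound
    (((hπ.measurable_scoreSum hU hθ t).inner_const).pow_const 2).aestronglyMeasurable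
    (((t + 1) * Mg * ‖u‖) ^ 2) (Filter.Eventually.of_forall fun τ => ?_)
  rw [norm_pow]
  gcongr
  refine (abs_real_inner_le_norm _ _).trans ?_
  gcongr
  exact hπ.norm_scoreSum_le hθ t τ

/-- Cauchy–Schwarz: with v the gradient, ‖v‖² = E[r ⟪v, S_t⟫] ≤ (E⟪v, S_t⟫²)^(1/2), and the
martingale bound controls the right side. -/
lemma norm_rewardGrad_le (hMg : 0 < Mg) (hπ : π.BoundedScore U Mg Mh) (hU : IsOpen U)
    (hθ : θ ∈ U) (i : Fin (m + 1)) (t : ℕ) :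
    ‖M.rewardGrad π i t θ‖ ≤ Mg * √(t + 1) := by
  set v := M.rewardGrad π i t θ with hv
  rcases eq_or_ne v 0 with h0 | h0
  · rw [h0, norm_zero]; positivity
  have hv0 : 0 < ‖v‖ := norm_pos_iff.2 h0
  -- Cauchy–Schwarz is carried out through |f| ≤ f²/(2c) + c/2, with c the bound on the root mean
  -- square of f, so that both halves contribute c/2.
  set c : ℝ := √(t + 1) * (Mg * ‖v‖) with hc
  have hc0 : 0 < c := by positivity
  have hint := M.integrable_r_smul_scoreSum hπ hU hθ i t
  have hsq := M.integrable_sq_inner_scoreSum hπ hU hθ v t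
  have h1 : ‖v‖ ^ 2 = ∫ τ, ⟪v, M.r i (τ t) • π.scoreSum θ t τ⟫ ∂M.trajLaw π θ := by
    rw [integral_inner hint, ← real_inner_self_eq_norm_sq]; rfl
  have h2 : ∀ τ : ℕ → S × A, ⟪v, M.r i (τ t) • π.scoreSum θ t τ⟫ ≤
      ⟪π.scoreSum θ t τ, v⟫ ^ 2 / (2 * c) + c / 2 := by
    intro τ
    set f := ⟪π.scoreSum θ t τ, v⟫
    rw [real_inner_smul_right, real_inner_comm]
    have h3 : M.r i (τ t) * f ≤ |f| := (le_abs_self _).trans (by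
      rw [abs_mul]; exact mul_le_of_le_one_left (abs_nonneg _) (M.abs_r_le i _))
    have h4 : |f| ≤ f ^ 2 / (2 * c) + c / 2 := by
      rw [← sq_abs, div_add_div _ _ (by positivity) two_ne_zero, le_div_iff₀ (by positivity)]
      nlinarith [sq_nonneg (|f| - c)]
    exact h3.trans h4
  have h5 : ‖v‖ ^ 2 ≤ c := by
    rw [h1]
    refine (integral_mono (hint.const_inner v) ((hsq.div_const _).add (integrable_const _))
      h2).trans ?_
    have h6 := M.integral_sq_inner_scoreSum_le hπ hU hθ v t
    simp only [Pi.add_apply]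
    rw [integral_add (hsq.div_const _) (integrable_const _), integral_div]
    simp only [integral_const, probReal_univ, one_smul]
    have h7 : (t + 1 : ℝ) * (Mg * ‖v‖) ^ 2 = c ^ 2 := by
      rw [hc, mul_pow (√_), Real.sq_sqrt (by positivity)]
    rw [h7] at h6
    calc _ ≤ c ^ 2 / (2 * c) + c / 2 := by gcongr
      _ = c := by field_simp; ring
  have h8 : ‖v‖ * ‖v‖ ≤ (Mg * √(t + 1)) * ‖v‖ := by rw [hc] at h5; linarith
  exact le_of_mul_le_mul_right h8 hv0

lemma norm_rewardGrad_le_linear (hMg : 0 < Mg) (hπ : π.BoundedScore U Mg Mh) (hU : IsOpen U)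
    (hθ : θ ∈ U) (i : Fin (m + 1)) (t : ℕ) :
    ‖M.rewardGrad π i t θ‖ ≤ Mg * (t + 1) := by
  refine (M.norm_rewardGrad_le hMg hπ hU hθ i t).trans (mul_le_mul_of_nonneg_left ?_ hMg.le)
  have ht := Nat.cast_nonneg (α := ℝ) t
  exact Real.sqrt_le_iff.2 ⟨by linarith, by nlinarith⟩

lemma hasSum_gradBound (Mg : ℝ) :
    HasSum (fun t : ℕ => M.γ ^ t * (Mg * ((t : ℝ) + 1))) (Mg / (1 - M.γ) ^ 2) := by
  rw [← mul_one_div]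
  simp_rw [mul_left_comm]
  exact (hasSum_geometric_mul_succ M.γ_pos.le M.γ_lt_one).mul_left Mg

lemma norm_pow_smul_rewardGrad_le (hMg : 0 < Mg) (hπ : π.BoundedScore U Mg Mh) (hU : IsOpen U)
    (hθ : θ ∈ U) (i : Fin (m + 1)) (t : ℕ) :
    ‖M.γ ^ t • M.rewardGrad π i t θ‖ ≤ M.γ ^ t * (Mg * (t + 1)) := by
  rw [norm_smul, Real.norm_of_nonneg (pow_nonneg M.γ_pos.le t)]
  exact mul_le_mul_of_nonneg_left (M.norm_rewardGrad_le_linear hMg hπ hU hθ i t)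
    (pow_nonneg M.γ_pos.le t)

lemma summable_rewardGrad (hMg : 0 < Mg) (hπ : π.BoundedScore U Mg Mh) (hU : IsOpen U)
    (hθ : θ ∈ U) (i : Fin (m + 1)) : Summable fun t => M.γ ^ t • M.rewardGrad π i t θ :=
  Summable.of_norm_bounded (M.hasSum_gradBound Mg).summable
    (M.norm_pow_smul_rewardGrad_le hMg hπ hU hθ i)

/-- Termwise differentiation of the discounted series, with a summable bound on the gradients that
is uniform over a ball inside U. -/
lemma hasGradientAt_value (hMg : 0 < Mg) (hπ : π.BoundedScore U Mg Mh) (hU : IsOpen U)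
    (hθ : θ ∈ U) (i : Fin (m + 1)) :
    HasGradientAt (M.value π i) (∑' t, M.γ ^ t • M.rewardGrad π i t θ) θ := by
  obtain ⟨ε, hε, hball⟩ := Metric.isOpen_iff.1 hU θ hθ
  have h := hasFDerivAt_tsum_of_isPreconnected (𝕜 := ℝ)
    (f := fun t η => M.γ ^ t * M.expReward π i t η)
    (f' := fun t η => InnerProductSpace.toDual ℝ _ (M.γ ^ t • M.rewardGrad π i t η))
    (M.hasSum_gradBound Mg).summable Metric.isOpen_ball (convex_ball θ ε).isPreconnected
    (fun t η hη => by
      have := (M.hasGradientAt_expReward hπ hU (hball hη) i t).hasFDerivAt.const_mul (M.γ ^ t)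
      simpa using this)
    (fun t η hη => by
      rw [LinearIsometryEquiv.norm_map]
      exact M.norm_pow_smul_rewardGrad_le hMg hπ hU (hball hη) i t)
    (Metric.mem_ball_self hε) (M.value_eq_tsum π i θ).summable (Metric.mem_ball_self hε)
  have hs := (M.summable_rewardGrad hMg hπ hU hθ i).hasSum.map
    (InnerProductSpace.toDual ℝ (EuclideanSpace ℝ (Fin d)))
    (InnerProductSpace.toDual ℝ (EuclideanSpace ℝ (Fin d))).continuous
  rw [hasGradientAt_iff_hasFDerivAt]
  refine (h.congr_fderiv hs.tsum_eq).congr_of_eventuallyEq (Filter.Eventually.of_forall fun η => ?_)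
  exact (M.value_eq_tsum π i η).tsum_eq.symm

lemma norm_gradient_value_le (hMg : 0 < Mg) (hπ : π.BoundedScore U Mg Mh) (hU : IsOpen U)
    (hθ : θ ∈ U) (i : Fin (m + 1)) :
    ‖∑' t, M.γ ^ t • M.rewardGrad π i t θ‖ ≤ Mg / (1 - M.γ) ^ 2 :=
  tsum_of_norm_bounded (M.hasSum_gradBound Mg) (M.norm_pow_smul_rewardGrad_le hMg hπ hU hθ i)

lemma lipschitzContOn_value (hMg : 0 < Mg) (hπ : π.BoundedScore U Mg Mh) (hU : IsOpen U)
    (i : Fin (m + 1)) {X : Set (EuclideanSpace ℝ (Fin d))} (hX : convexHull ℝ X ⊆ U) :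
    LipschitzContOn (M.value π i) (Mg / (1 - M.γ) ^ 2) X := fun x hx y hy =>
  (convex_convexHull ℝ X).norm_image_sub_le_of_norm_hasFDerivWithin_le (𝕜 := ℝ)
    (fun η hη => (M.hasGradientAt_value hMg hπ hU (hX hη) i).hasFDerivAt.hasFDerivWithinAt)
    (fun η hη => by simpa using M.norm_gradient_value_le hMg hπ hU (hX hη) i)
    (subset_convexHull ℝ X hy) (subset_convexHull ℝ X hx)

lemma hasGradientAt_inner_scoreSum (hπ : π.BoundedScore U Mg Mh) (hθ : θ ∈ U) (t : ℕ)
    (u : EuclideanSpace ℝ (Fin d)) (τ : ℕ → S × A) :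
    HasGradientAt (fun η => ⟪u, π.scoreSum η t τ⟫) (∑ k ∈ Finset.range (t + 1),
      ContinuousLinearMap.adjoint (π.hessian θ (τ k).1 (τ k).2) u) θ := by
  simp only [PolicyFamily.scoreSum, inner_sum]
  refine HasGradientAt.finset_sum fun k _ => ?_
  have h := (innerSL ℝ u).hasFDerivAt.comp θ
    (hπ.differentiableAt_score θ hθ (τ k).1 (τ k).2).hasFDerivAt
  rw [hasGradientAt_iff_hasFDerivAt]
  refine h.congr_fderiv ?_
  ext v
  simp [ContinuousLinearMap.adjoint_inner_left, PolicyFamily.hessian]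

lemma norm_sum_adjoint_hessian_le (hπ : π.BoundedScore U Mg Mh) (hθ : θ ∈ U) (t : ℕ)
    (u : EuclideanSpace ℝ (Fin d)) (τ : ℕ → S × A) :
    ‖∑ k ∈ Finset.range (t + 1),
      ContinuousLinearMap.adjoint (π.hessian θ (τ k).1 (τ k).2) u‖ ≤ (t + 1) * (Mh * ‖u‖) := by
  refine (norm_sum_le_of_le (f := fun k => ContinuousLinearMap.adjoint
    (π.hessian θ (τ k).1 (τ k).2) u) (n := fun _ => Mh * ‖u‖) _ fun k _ => ?_).trans ?_
  · refine ((ContinuousLinearMap.le_opNorm _ _)).trans ?_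
    rw [LinearIsometryEquiv.norm_map]
    gcongr
    exact hπ.norm_hessian_le θ hθ _ _
  · simp

/-- A second differentiation gives D = E[r ⟪u, S_t⟫ S_t + r H], H the sum of adjoint Hessians
applied to u. Paired with u, the first part is at most E⟪S_t, u⟫², where the martingale bound
enters, and the second is bounded pointwise. Using adjoints avoids appealing to symmetry of the
Hessian. -/
lemma exists_hasGradientAt_inner_rewardGrad (hπ : π.BoundedScore U Mg Mh) (hU : IsOpen U)
    (hθ : θ ∈ U) (i : Fin (m + 1)) (t : ℕ) (u : EuclideanSpace ℝ (Fin d)) :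
    ∃ D, HasGradientAt (fun η => ⟪u, M.rewardGrad π i t η⟫) D θ ∧
      ⟪D, u⟫ ≤ (t + 1) * ((Mg ^ 2 + Mh) * ‖u‖ ^ 2) := by
  set H : EuclideanSpace ℝ (Fin d) → (ℕ → S × A) → EuclideanSpace ℝ (Fin d) := fun η τ =>
    ∑ k ∈ Finset.range (t + 1), ContinuousLinearMap.adjoint (π.hessian η (τ k).1 (τ k).2) u
    with hH
  have hr : ∀ τ : ℕ → S × A, |M.r i (τ t)| ≤ 1 := fun τ => M.abs_r_le i _
  have hHn : ∀ η ∈ U, ∀ τ, ‖H η τ‖ ≤ (t + 1) * (Mh * ‖u‖) := fun η hη τ =>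
    norm_sum_adjoint_hessian_le hπ hη t u τ
  have hgm : ∀ η ∈ U, Measurable fun τ : ℕ → S × A => M.r i (τ t) * ⟪u, π.scoreSum η t τ⟫ :=
    fun η hη => (M.measurable_r_eval i t).mul ((hπ.measurable_scoreSum hU hη t).const_inner)
  have hgg : ∀ η ∈ U, ∀ τ : ℕ → S × A,
      HasGradientAt (fun η => M.r i (τ t) * ⟪u, π.scoreSum η t τ⟫) (M.r i (τ t) • H η τ) η :=
    fun η hη τ => by
      have := (hasGradientAt_inner_scoreSum hπ hη t u τ).hasFDerivAt.const_mul (M.r i (τ t))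
      rw [hasGradientAt_iff_hasFDerivAt]
      simpa [hH] using this
  have hgb : ∀ η ∈ U, ∀ τ : ℕ → S × A,
      |M.r i (τ t) * ⟪u, π.scoreSum η t τ⟫| ≤ ‖u‖ * ((t + 1) * Mg) := fun η hη τ => by
    rw [abs_mul]
    refine (mul_le_of_le_one_left (abs_nonneg _) (hr τ)).trans
      ((abs_real_inner_le_norm _ _).trans ?_)
    gcongr
    exact hπ.norm_scoreSum_le hη t τ
  have hgb' : ∀ η ∈ U, ∀ τ : ℕ → S × A, ‖M.r i (τ t) • H η τ‖ ≤ (t + 1) * (Mh * ‖u‖) :=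
    fun η hη τ => by
      rw [norm_smul]
      exact (mul_le_of_le_one_left (norm_nonneg _) (hr τ)).trans (hHn η hη τ)
  have h := M.hasGradientAt_integral_trajLaw hπ hU hθ t hgm
    (fun η hη τ τ' h => by
      simp only [h t (Set.mem_Iic.2 le_rfl), π.dependsOn_scoreSum η t h]) hgg hgb hgb'
  refine ⟨_, h.congr_of_eventuallyEq ?_, ?_⟩
  · filter_upwards [hU.mem_nhds hθ] with η hη
    rw [rewardGrad, ← integral_inner (M.integrable_r_smul_scoreSum hπ hU hη i t)]
    simp_rw [real_inner_smul_right]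
  obtain ⟨ε, hε, hball⟩ := Metric.isOpen_iff.1 hU θ hθ
  have hHm : Measurable fun τ : ℕ → S × A => M.r i (τ t) • H θ τ :=
    measurable_of_hasGradientAt hε (fun η hη => hgm η (hball hη)) (hgg θ hθ)
  have hi1 : Integrable (fun τ : ℕ → S × A =>
      (M.r i (τ t) * ⟪u, π.scoreSum θ t τ⟫) • π.scoreSum θ t τ + M.r i (τ t) • H θ τ)
      (M.trajLaw π θ) := by
    refine Integrable.of_bound (((hgm θ hθ).smul
      (hπ.measurable_scoreSum hU hθ t)).add hHm).aestronglyMeasurable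
      (‖u‖ * ((t + 1) * Mg) * ((t + 1) * Mg) + (t + 1) * (Mh * ‖u‖))
      (Filter.Eventually.of_forall fun τ => ?_)
    refine (norm_add_le _ _).trans (add_le_add ?_ (hgb' θ hθ τ))
    rw [norm_smul]
    exact mul_le_mul (hgb θ hθ τ) (hπ.norm_scoreSum_le hθ t τ) (norm_nonneg _)
      ((abs_nonneg _).trans (hgb θ hθ τ))
  rw [real_inner_comm, ← integral_inner hi1]
  have hsq := M.integrable_sq_inner_scoreSum hπ hU hθ u t
  calc _ ≤ ∫ τ, (⟪π.scoreSum θ t τ, u⟫ ^ 2 + (t + 1) * (Mh * ‖u‖ ^ 2)) ∂M.trajLaw π θ := by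
        refine integral_mono (hi1.const_inner u) (hsq.add (integrable_const _)) fun τ => ?_
        simp only [inner_add_right, real_inner_smul_right]
        refine add_le_add ?_ ?_
        · rw [real_inner_comm u, mul_assoc, ← sq]
          exact mul_le_of_le_one_left (sq_nonneg _) ((le_abs_self _).trans (hr τ))
        · rw [← real_inner_smul_right]
          refine (real_inner_le_norm _ _).trans ?_
          calc ‖u‖ * ‖M.r i (τ t) • H θ τ‖ ≤ ‖u‖ * ((t + 1) * (Mh * ‖u‖)) := by
                gcongr; exact hgb' θ hθ τ
            _ = _ := by ring
    _ ≤ _ := by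
        rw [integral_add hsq (integrable_const _)]
        simp only [integral_const, probReal_univ, one_smul]
        have := M.integral_sq_inner_scoreSum_le hπ hU hθ u t
        calc _ ≤ (t + 1) * (Mg * ‖u‖) ^ 2 + (t + 1) * (Mh * ‖u‖ ^ 2) := by gcongr
          _ = _ := by ring

lemma expReward_le_taylor (hπ : π.BoundedScore U Mg Mh) (hU : IsOpen U) (i : Fin (m + 1)) (t : ℕ)
    {x y : EuclideanSpace ℝ (Fin d)} (hxy : segment ℝ y x ⊆ U) :
    M.expReward π i t x ≤ M.expReward π i t y + ⟪M.rewardGrad π i t y, x - y⟫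
      + (t + 1) * ((Mg ^ 2 + Mh) * ‖x - y‖ ^ 2) / 2 := by
  set u := x - y with hu
  have hmem : ∀ s ∈ Set.Icc (0 : ℝ) 1, y + s • u ∈ U := fun s hs => by
    refine hxy ?_
    rw [segment_eq_image']
    exact ⟨s, hs, rfl⟩
  choose! D hD hDle using fun η (hη : η ∈ U) =>
    M.exists_hasGradientAt_inner_rewardGrad hπ hU hη i t u
  have hline : ∀ s : ℝ, HasDerivAt (fun s : ℝ => y + s • u) u s := fun s => by
    simpa using ((hasDerivAt_id s).smul_const u).const_add y
  have h := le_taylor_of_second_deriv_le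
    (f := fun s : ℝ => M.expReward π i t (y + s • u))
    (f' := fun s : ℝ => ⟪u, M.rewardGrad π i t (y + s • u)⟫)
    (f'' := fun s => ⟪D (y + s • u), u⟫)
    (K := (t + 1) * ((Mg ^ 2 + Mh) * ‖u‖ ^ 2))
    (fun s hs => by
      have := (M.hasGradientAt_expReward hπ hU (hmem s hs) i t).hasFDerivAt.comp_hasDerivAt s
        (hline s)
      rw [InnerProductSpace.toDual_apply_apply, real_inner_comm] at this
      exact this)
    (fun s hs => by
      have := (hD _ (hmem s hs)).hasFDerivAt.comp_hasDerivAt s (hline s)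
      rw [InnerProductSpace.toDual_apply_apply] at this
      exact this)
    (fun s hs => hDle _ (hmem s hs))
  simp only [one_smul, zero_smul, add_zero] at h
  rw [real_inner_comm, show y + u = x by rw [hu]; abel] at h
  exact h

lemma mSmoothOn_value (hMg : 0 < Mg) (hπ : π.BoundedScore U Mg Mh) (hU : IsOpen U)
    (i : Fin (m + 1)) {X : Set (EuclideanSpace ℝ (Fin d))} (hX : convexHull ℝ X ⊆ U) :
    MSmoothOn (M.value π i) ((Mg ^ 2 + Mh) / (1 - M.γ) ^ 2) X := by
  intro x hx y hy
  have hy' := subset_convexHull ℝ X hy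
  have hseg : segment ℝ y x ⊆ U :=
    ((convex_convexHull ℝ X).segment_subset hy' (subset_convexHull ℝ X hx)).trans hX
  rw [(M.hasGradientAt_value hMg hπ hU (hX hy') i).gradient]
  -- The Taylor bounds for the separate times are summed with weights γ^t; the factors t + 1 in the
  -- quadratic terms sum to 1/(1-γ)².
  have h1 := (M.summable_rewardGrad hMg hπ hU (hX hy') i).hasSum.mapL (innerSL ℝ (x - y))
  have h2 := ((hasSum_geometric_mul_succ M.γ_pos.le M.γ_lt_one).mul_right
    ((Mg ^ 2 + Mh) * ‖x - y‖ ^ 2 / 2))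
  refine (hasSum_le (fun t => ?_) (M.value_eq_tsum π i x)
    (((M.value_eq_tsum π i y).add h1).add h2)).trans_eq ?_
  · simp only [innerSL_apply_apply, real_inner_smul_right]
    rw [real_inner_comm]
    have h3 := mul_le_mul_of_nonneg_left (M.expReward_le_taylor hπ hU i t hseg)
      (pow_nonneg M.γ_pos.le t)
    refine h3.trans_eq ?_
    ring
  · rw [innerSL_apply_apply, real_inner_comm]
    ring

end CMDP

end

/-! ### Numerical inequalities behind the tail bound -/

section RealInequalities

lemma Real.one_add_sq_div_two_le_cosh (x : ℝ) : 1 + x ^ 2 / 2 ≤ Real.cosh x := by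
  have h1 : Real.cosh x = 1 + 2 * Real.sinh (x / 2) ^ 2 := by
    have h := Real.cosh_two_mul (x / 2)
    rw [Real.cosh_sq, mul_div_cancel₀ x two_ne_zero] at h
    linarith
  have h2 : (x / 2) ^ 2 ≤ Real.sinh (x / 2) ^ 2 := by
    rw [← sq_abs, ← sq_abs (Real.sinh _)]
    have h3 : |x / 2| ≤ |Real.sinh (x / 2)| := by
      rw [Real.abs_sinh]
      exact Real.self_le_sinh_iff.2 (abs_nonneg _)
    gcongr
  rw [h1]
  linarith [h2, (by ring : x ^ 2 / 2 = 2 * (x / 2) ^ 2)]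

lemma Real.convexOn_cosh : ConvexOn ℝ Set.univ Real.cosh := by
  refine ⟨convex_univ, fun x _ y _ a b ha hb hab => ?_⟩
  have h1 := convexOn_exp.2 (Set.mem_univ x) (Set.mem_univ y) ha hb hab
  have h2 := convexOn_exp.2 (Set.mem_univ (-x)) (Set.mem_univ (-y)) ha hb hab
  simp only [smul_eq_mul] at *
  rw [mul_neg, mul_neg, ← neg_add] at h2
  simp only [Real.cosh_eq]
  linarith

lemma Real.sinh_sub_self_le (x : ℝ) : Real.sinh x - x ≤ Real.cosh x - 1 := by
  have h := Real.add_one_le_exp (-x)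
  rw [← Real.cosh_sub_sinh] at h
  linarith

lemma Real.cosh_sub_mul_sinh_le_one (x : ℝ) : Real.cosh x - x * Real.sinh x ≤ 1 := by
  have h1 : Real.exp x * (1 - x) ≤ 1 := by
    have := mul_le_mul_of_nonneg_left (Real.one_sub_le_exp_neg x) (Real.exp_pos x).le
    rwa [← Real.exp_add, add_neg_cancel, Real.exp_zero] at this
  have h2 : Real.exp (-x) * (x + 1) ≤ 1 := by
    have := mul_le_mul_of_nonneg_left (Real.add_one_le_exp x) (Real.exp_pos (-x)).le
    rwa [← Real.exp_add, neg_add_cancel, Real.exp_zero] at this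
  rw [Real.cosh_eq, Real.sinh_eq]
  linarith

/-- For small x the left side is close to 1 + x²; the slack up to 3x²/2 absorbs the factor exp x ≤
1.4 and the quadratic remainder of the exponential. -/
lemma one_add_two_mul_exp_mul_le {x : ℝ} (h0 : 0 ≤ x) (h1 : x ≤ 1 / 3) :
    1 + 2 * Real.exp x * (Real.exp (x ^ 2 / 2) - 1) ≤ Real.exp (3 * x ^ 2 / 2) := by
  set z := x ^ 2 / 2 with hz
  have hz0 : 0 ≤ z := by positivity
  have hz1 : z ≤ 1 / 18 := by nlinarith
  have he : Real.exp x ≤ 1.4 := by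
    refine (Real.exp_le_exp.2 h1).trans ?_
    have h : Real.exp (1 / 3) ^ 3 ≤ (1.4 : ℝ) ^ 3 := by
      rw [← Real.exp_nat_mul]
      norm_num
      linarith [Real.exp_one_lt_d9]
    exact le_of_pow_le_pow_left₀ three_ne_zero (by norm_num) h
  have hz2 : Real.exp z - 1 ≤ z + z ^ 2 := by
    have := (abs_le.1 (Real.abs_exp_sub_one_sub_id_le
      (by rw [abs_of_nonneg hz0]; linarith : |z| ≤ 1))).2
    linarith
  have h3 := Real.add_one_le_exp (3 * z)
  have h4 : (0 : ℝ) ≤ Real.exp z - 1 := by linarith [Real.add_one_le_exp z]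
  have h5 : 2 * Real.exp x * (Real.exp z - 1) ≤ 2 * 1.4 * (z + z ^ 2) := by gcongr
  have h6 : 3 * x ^ 2 / 2 = 3 * z := by rw [hz]; ring
  rw [h6]
  nlinarith

lemma two_mul_exp_le_of_sixteen_le {y : ℝ} (hy : 16 ≤ y) :
    2 * Real.exp (-(y / 6)) ≤ Real.exp (1 / 4 - y / 8) := by
  have h : (2 : ℝ) = Real.exp (Real.log 2) := (Real.exp_log two_pos).symm
  rw [h, ← Real.exp_add, Real.exp_le_exp]
  linarith [Real.log_two_lt_d9]

/-- With s = y/8 - 1/4 ∈ [0, 2], convexity and e² ≤ 9 give exp s ≤ 1 + 4s, and 1.3 (1 + 4s) ≤ 8s + 2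
= y. -/
lemma chebyshev_le_exp {y : ℝ} (h1 : 2 ≤ y) (h2 : y ≤ 16) :
    1.3 / y ≤ Real.exp (1 / 4 - y / 8) := by
  set s := y / 8 - 1 / 4 with hs
  have hs0 : 0 ≤ s := by rw [hs]; linarith
  have hs2 : s ≤ 2 := by rw [hs]; linarith
  have hexp : Real.exp s ≤ 1 + 4 * s := by
    have h := convexOn_exp.2 (Set.mem_univ 0) (Set.mem_univ 2) (by linarith : 0 ≤ 1 - s / 2)
      (by linarith : 0 ≤ s / 2) (by ring)
    have h2 : Real.exp 2 ≤ 9 := by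
      have : Real.exp 2 = Real.exp 1 ^ 2 := by rw [← Real.exp_nat_mul]; norm_num
      rw [this]
      nlinarith [Real.exp_one_lt_d9, Real.exp_pos 1]
    simp only [smul_eq_mul, mul_zero, zero_add, Real.exp_zero] at h
    rw [div_mul_cancel₀ s two_ne_zero] at h
    nlinarith
  have hy : 1 / 4 - y / 8 = -s := by rw [hs]; ring
  rw [hy, Real.exp_neg, div_le_iff₀ (by linarith), ← div_eq_inv_mul,
    le_div_iff₀ (Real.exp_pos _)]
  nlinarith

end RealInequalities

/-! ### Concentration of sums of independent random vectors -/

section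

variable {E : Type*} [NormedAddCommGroup E] [InnerProductSpace ℝ E]

/-- In `Real.cosh_norm_add_le` with b = ‖y‖ the coefficient of ⟪z, y⟫ depends on y. Replacing
sinh‖y‖/‖y‖ by 1 makes this term linear in y, and Cauchy–Schwarz bounds the excess by sinh‖z‖
(sinh‖y‖ - ‖y‖). -/
lemma Real.cosh_norm_add_le_of_sinh (z y : E) :
    Real.cosh ‖z + y‖ ≤ Real.cosh ‖z‖ * Real.cosh ‖y‖
      + Real.sinh ‖z‖ * (Real.sinh ‖y‖ - ‖y‖) + ⟪z, y⟫ * (Real.sinh ‖z‖ / ‖z‖) := by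
  have h := Real.cosh_norm_add_le z (le_refl ‖y‖)
  have hy : ‖y‖ ≤ Real.sinh ‖y‖ := Real.self_le_sinh_iff.2 (norm_nonneg y)
  have hz : ‖z‖ ≤ Real.sinh ‖z‖ := Real.self_le_sinh_iff.2 (norm_nonneg z)
  rcases eq_or_ne z 0 with rfl | hz0
  · simp
  rcases eq_or_ne y 0 with rfl | hy0
  · simp
  have hz' : 0 < ‖z‖ := norm_pos_iff.2 hz0
  have hy' : 0 < ‖y‖ := norm_pos_iff.2 hy0
  have h1 : ⟪z, y⟫ * (Real.sinh ‖z‖ / ‖z‖) * (Real.sinh ‖y‖ / ‖y‖) =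
      ⟪z, y⟫ * ((Real.sinh ‖z‖ / ‖z‖) * ((Real.sinh ‖y‖ - ‖y‖) / ‖y‖))
        + ⟪z, y⟫ * (Real.sinh ‖z‖ / ‖z‖) := by
    field_simp; ring
  have h2 : ⟪z, y⟫ * ((Real.sinh ‖z‖ / ‖z‖) * ((Real.sinh ‖y‖ - ‖y‖) / ‖y‖)) ≤
      (‖z‖ * ‖y‖) * ((Real.sinh ‖z‖ / ‖z‖) * ((Real.sinh ‖y‖ - ‖y‖) / ‖y‖)) := by
    refine mul_le_mul_of_nonneg_right (real_inner_le_norm z y) (mul_nonneg ?_ ?_)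
    · exact div_nonneg (hz'.le.trans hz) hz'.le
    · exact div_nonneg (by linarith) hy'.le
  have h3 : (‖z‖ * ‖y‖) * ((Real.sinh ‖z‖ / ‖z‖) * ((Real.sinh ‖y‖ - ‖y‖) / ‖y‖)) =
      Real.sinh ‖z‖ * (Real.sinh ‖y‖ - ‖y‖) := by field_simp
  linarith

variable [CompleteSpace E] [MeasurableSpace E] [BorelSpace E] [SecondCountableTopology E]
  {Ω : Type*} [MeasurableSpace Ω] {μ : Measure Ω} [IsProbabilityMeasure μ]

lemma ProbabilityTheory.IndepFun.integral_add_le {W Y : Ω → E} {f g : E → ℝ}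
    (h : IndepFun W Y μ) (hW : AEMeasurable W μ) (hY : AEMeasurable Y μ) (hf : Continuous f)
    (hg : Continuous g) (hfi : Integrable (fun ω => f (W ω + Y ω)) μ)
    (hgi : Integrable (fun ω => g (W ω)) μ) (hle : ∀ w, ∫ ω, f (w + Y ω) ∂μ ≤ g w) :
    ∫ ω, f (W ω + Y ω) ∂μ ≤ ∫ ω, g (W ω) ∂μ := by
  have hWp := Measure.isProbabilityMeasure_map hW
  have hYp := Measure.isProbabilityMeasure_map hY
  have hmap := (indepFun_iff_map_prod_eq_prod_map_map hW hY).1 h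
  have hF : Continuous fun p : E × E => f (p.1 + p.2) := by fun_prop
  have hWY : AEMeasurable (fun ω => (W ω, Y ω)) μ := hW.prodMk hY
  have hFi : Integrable (fun p : E × E => f (p.1 + p.2)) ((μ.map W).prod (μ.map Y)) := by
    rw [← hmap]
    exact (integrable_map_measure hF.aestronglyMeasurable hWY).2 hfi
  have hGi : Integrable g (μ.map W) := (integrable_map_measure hg.aestronglyMeasurable hW).2 hgi
  calc ∫ ω, f (W ω + Y ω) ∂μ
      = ∫ p, f (p.1 + p.2) ∂((μ.map W).prod (μ.map Y)) := by
        rw [← hmap, integral_map hWY hF.aestronglyMeasurable]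
    _ = ∫ w, ∫ y, f (w + y) ∂μ.map Y ∂μ.map W := integral_prod _ hFi
    _ ≤ ∫ w, g w ∂μ.map W := by
        refine integral_mono hFi.integral_prod_left hGi fun w => ?_
        simp only
        rw [integral_map hY (f := fun y => f (w + y))
          (hf.comp (continuous_const_add w)).aestronglyMeasurable]
        exact hle w
    _ = _ := integral_map hW hg.aestronglyMeasurable

/-- An integrability criterion for continuous functions of bounded random vectors. -/
lemma integrable_comp_norm_of_bound {W : Ω → E} {B : ℝ} (hW : AEMeasurable W μ)
    (hB : ∀ ω, ‖W ω‖ ≤ B) {φ : ℝ → ℝ} (hφ : Continuous φ) :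
    Integrable (fun ω => φ ‖W ω‖) μ := by
  obtain ⟨C, hC⟩ := (isCompact_Icc (a := (0 : ℝ)) (b := B)).exists_bound_of_continuousOn
    hφ.continuousOn
  exact Integrable.of_bound (hφ.comp_aestronglyMeasurable hW.aestronglyMeasurable.norm) C
    (Filter.Eventually.of_forall fun ω => hC _ ⟨norm_nonneg _, hB ω⟩)

/-- Adding an independent centered summand removes the linear term, and sinh‖w‖ ≤ cosh‖w‖ lets
cosh‖w‖ be factored out, so each summand costs one factor K. -/
lemma integral_cosh_norm_sum_le {ι : Type*} {Y : ι → Ω → E} {B K : ℝ}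
    (hind : iIndepFun Y μ) (hm : ∀ j, AEMeasurable (Y j) μ) (hB : ∀ j ω, ‖Y j ω‖ ≤ B)
    (h0 : ∀ j, ∫ ω, Y j ω ∂μ = 0)
    (hK : ∀ j, ∫ ω, (Real.cosh ‖Y j ω‖ + (Real.sinh ‖Y j ω‖ - ‖Y j ω‖)) ∂μ ≤ K) (s : Finset ι) :
    ∫ ω, Real.cosh ‖∑ j ∈ s, Y j ω‖ ∂μ ≤ K ^ s.card := by
  classical
  have hsm : ∀ s : Finset ι, AEMeasurable (∑ j ∈ s, Y j) μ := fun s =>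
    Finset.aemeasurable_sum _ fun j _ => hm j
  have hsb : ∀ (s : Finset ι) ω, ‖(∑ j ∈ s, Y j) ω‖ ≤ s.card * B := fun s ω => by
    rw [Finset.sum_apply]
    refine (norm_sum_le_of_le _ fun j _ => hB j ω).trans ?_
    simp
  have hK0 : ∀ j, 0 ≤ K := fun j => (hK j).trans' <| integral_nonneg fun ω =>
    add_nonneg (Real.cosh_pos _).le
      (sub_nonneg.2 (Real.self_le_sinh_iff.2 (norm_nonneg _)))
  simp_rw [← Finset.sum_apply]
  induction s using Finset.induction_on with
  | empty => simp
  | insert i s hi ih =>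
    have hind' := hind.indepFun_finsetSum_of_notMem₀ hm hi
    have hIc := integrable_comp_norm_of_bound (hm i) (hB i) (Real.continuous_cosh)
    have hIs := integrable_comp_norm_of_bound (hm i) (hB i) (φ := fun x => Real.sinh x - x)
      (Real.continuous_sinh.sub continuous_id)
    have hIy : Integrable (Y i) μ := Integrable.of_bound (hm i).aestronglyMeasurable B
      (Filter.Eventually.of_forall (hB i))
    have hadd : ∀ ω, (∑ j ∈ insert i s, Y j) ω = (∑ j ∈ s, Y j) ω + Y i ω := fun ω => by
      rw [Finset.sum_insert hi, Pi.add_apply, add_comm]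
    have hfi : Integrable (fun ω => Real.cosh ‖(∑ j ∈ s, Y j) ω + Y i ω‖) μ := by
      simp_rw [← hadd]
      exact integrable_comp_norm_of_bound (hsm _) (hsb _) Real.continuous_cosh
    have hstep : ∀ w : E, ∫ ω, Real.cosh ‖w + Y i ω‖ ∂μ ≤ Real.cosh ‖w‖ * K := by
      intro w
      have hpt : ∀ ω, Real.cosh ‖w + Y i ω‖ ≤
          Real.cosh ‖w‖ * (Real.cosh ‖Y i ω‖ + (Real.sinh ‖Y i ω‖ - ‖Y i ω‖))
            + ⟪w, Y i ω⟫ * (Real.sinh ‖w‖ / ‖w‖) := fun ω => by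
        have h1 := Real.cosh_norm_add_le_of_sinh w (Y i ω)
        have h2 := mul_le_mul_of_nonneg_right (Real.sinh_lt_cosh (x := ‖w‖)).le
          (sub_nonneg.2 (Real.self_le_sinh_iff.2 (norm_nonneg (Y i ω))))
        linarith
      have hI1 := (hIc.fun_add hIs).const_mul (Real.cosh ‖w‖)
      have hI2 := (hIy.const_inner (𝕜 := ℝ) w).mul_const (Real.sinh ‖w‖ / ‖w‖)
      refine (integral_mono_of_nonneg (Filter.Eventually.of_forall fun ω => (Real.cosh_pos _).le)
        (hI1.add hI2) (Filter.Eventually.of_forall hpt)).trans ?_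
      simp only [Pi.add_apply]
      rw [integral_add hI1 hI2, integral_mul_const, integral_inner hIy, h0, inner_zero_right,
        zero_mul, add_zero, integral_const_mul]
      exact mul_le_mul_of_nonneg_left (hK i) (Real.cosh_pos _).le
    have hgi : Integrable (fun ω => Real.cosh ‖(∑ j ∈ s, Y j) ω‖ * K) μ :=
      (integrable_comp_norm_of_bound (hsm s) (hsb s) Real.continuous_cosh).mul_const K
    simp_rw [hadd]
    refine (hind'.integral_add_le (f := fun x => Real.cosh ‖x‖) (g := fun x => Real.cosh ‖x‖ * K)
      (hsm s) (hm i) (by fun_prop) (by fun_prop) hfi hgi hstep).trans ?_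
    rw [integral_mul_const, Finset.card_insert_of_notMem hi, pow_succ]
    exact mul_le_mul_of_nonneg_right ih (hK0 i)

lemma integral_sq_norm_sum_le {ι : Type*} {Y : ι → Ω → E} {B K : ℝ}
    (hind : iIndepFun Y μ) (hm : ∀ j, AEMeasurable (Y j) μ) (hB : ∀ j ω, ‖Y j ω‖ ≤ B)
    (h0 : ∀ j, ∫ ω, Y j ω ∂μ = 0) (hK : ∀ j, ∫ ω, ‖Y j ω‖ ^ 2 ∂μ ≤ K) (s : Finset ι) :
    ∫ ω, ‖∑ j ∈ s, Y j ω‖ ^ 2 ∂μ ≤ s.card * K := by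
  classical
  have hsm : ∀ s : Finset ι, AEMeasurable (∑ j ∈ s, Y j) μ := fun s =>
    Finset.aemeasurable_sum _ fun j _ => hm j
  have hsb : ∀ (s : Finset ι) ω, ‖(∑ j ∈ s, Y j) ω‖ ≤ s.card * B := fun s ω => by
    rw [Finset.sum_apply]
    refine (norm_sum_le_of_le _ fun j _ => hB j ω).trans ?_
    simp
  simp_rw [← Finset.sum_apply]
  induction s using Finset.induction_on with
  | empty => simp
  | insert i s hi ih =>
    have hind' := hind.indepFun_finsetSum_of_notMem₀ hm hi
    have hIs := integrable_comp_norm_of_bound (hm i) (hB i) (continuous_pow 2)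
    have hIy : Integrable (Y i) μ := Integrable.of_bound (hm i).aestronglyMeasurable B
      (Filter.Eventually.of_forall (hB i))
    have hadd : ∀ ω, (∑ j ∈ insert i s, Y j) ω = (∑ j ∈ s, Y j) ω + Y i ω := fun ω => by
      rw [Finset.sum_insert hi, Pi.add_apply, add_comm]
    have hfi : Integrable (fun ω => ‖(∑ j ∈ s, Y j) ω + Y i ω‖ ^ 2) μ := by
      simp_rw [← hadd]
      exact integrable_comp_norm_of_bound (hsm _) (hsb _) (continuous_pow 2)
    have hstep : ∀ w : E, ∫ ω, ‖w + Y i ω‖ ^ 2 ∂μ ≤ ‖w‖ ^ 2 + K := by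
      intro w
      simp_rw [norm_add_sq_real]
      have hI2 := (hIy.const_inner (𝕜 := ℝ) w).const_mul 2
      rw [integral_add ((integrable_const _).fun_add hI2) hIs, integral_add (integrable_const _) hI2,
        integral_const_mul, integral_inner hIy, h0]
      simpa using hK i
    have hsi := integrable_comp_norm_of_bound (hsm s) (hsb s) (continuous_pow 2)
    simp_rw [hadd]
    refine (hind'.integral_add_le (f := fun x => ‖x‖ ^ 2) (g := fun x => ‖x‖ ^ 2 + K)
      (hsm s) (hm i) (by fun_prop) (by fun_prop) hfi (hsi.add (integrable_const K)) hstep).trans ?_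
    rw [integral_add hsi (integrable_const K), Finset.card_insert_of_notMem hi]
    simp only [integral_const, probReal_univ, one_smul]
    push_cast
    linarith

/-- Effect of centering on the exponential moments of a random vector. -/
lemma integral_cosh_norm_sub_integral_le {X : Ω → E} {B : ℝ} (hm : AEMeasurable X μ)
    (hB : ∀ ω, ‖X ω‖ ≤ B) :
    ∫ ω, Real.cosh ‖X ω - ∫ ω', X ω' ∂μ‖ ∂μ ≤
      1 + Real.exp ‖∫ ω, X ω ∂μ‖ * (∫ ω, Real.cosh ‖X ω‖ ∂μ - 1) := by
  set z := ∫ ω, X ω ∂μ with hz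
  have hIx : Integrable X μ := Integrable.of_bound hm.aestronglyMeasurable B
    (Filter.Eventually.of_forall hB)
  have hIc := integrable_comp_norm_of_bound hm hB Real.continuous_cosh
  have hsz : 0 ≤ Real.sinh ‖z‖ := Real.sinh_nonneg_iff.2 (norm_nonneg z)
  have hpt : ∀ ω, Real.cosh ‖X ω - z‖ ≤
      Real.exp ‖z‖ * Real.cosh ‖X ω‖ - Real.sinh ‖z‖ - ⟪z, X ω⟫ * (Real.sinh ‖z‖ / ‖z‖) := by
    intro ω
    -- Bounding sinh‖X‖ - ‖X‖ by cosh‖X‖ - 1 merges cosh‖z‖ and sinh‖z‖ into exp‖z‖. The inner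
    -- product term is kept: it integrates to -‖z‖ sinh‖z‖, and cosh‖z‖ - ‖z‖ sinh‖z‖ ≤ 1 makes the
    -- constant come out as 1.
    have h1 := Real.cosh_norm_add_le_of_sinh (-z) (X ω)
    rw [neg_add_eq_sub, norm_neg, inner_neg_left] at h1
    have h2 := mul_le_mul_of_nonneg_left (Real.sinh_sub_self_le ‖X ω‖) hsz
    rw [← Real.cosh_add_sinh]
    linarith
  have hI1 := hIc.const_mul (Real.exp ‖z‖)
  have hI2 := (hIx.const_inner (𝕜 := ℝ) z).mul_const (Real.sinh ‖z‖ / ‖z‖)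
  have hI3 : Integrable (fun ω => Real.exp ‖z‖ * Real.cosh ‖X ω‖ - Real.sinh ‖z‖) μ :=
    hI1.sub (integrable_const _)
  refine (integral_mono_of_nonneg (Filter.Eventually.of_forall fun ω => (Real.cosh_pos _).le)
    (hI3.sub hI2) (Filter.Eventually.of_forall hpt)).trans ?_
  simp only [Pi.sub_apply]
  rw [integral_sub hI3 hI2,
    integral_sub hI1 (integrable_const _), integral_mul_const,
    integral_inner hIx, ← hz, integral_const_mul, real_inner_self_eq_norm_sq]
  simp only [integral_const, probReal_univ, one_smul]
  have h3 : ‖z‖ ^ 2 * (Real.sinh ‖z‖ / ‖z‖) = ‖z‖ * Real.sinh ‖z‖ := by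
    rcases eq_or_ne ‖z‖ 0 with h | h
    · simp [h]
    · field_simp
  have h4 := Real.cosh_sub_mul_sinh_le_one ‖z‖
  have h5 := Real.cosh_add_sinh ‖z‖
  rw [h3]
  linarith

/-- A tail bound for sums of independent, bounded random vectors with sub-Gaussian norm. -/
theorem measureReal_norm_sum_sub_integral_le {n : ℕ} {X : Fin n → Ω → E} {B σ y : ℝ}
    (hind : iIndepFun X μ) (hm : ∀ j, AEMeasurable (X j) μ) (hB : ∀ j ω, ‖X j ω‖ ≤ B)
    (hσ : 0 < σ) (hmean : ∀ j, ‖∫ ω, X j ω ∂μ‖ ≤ σ)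
    (hcosh : ∀ j (c : ℝ), 0 ≤ c →
      ∫ ω, Real.cosh (c * ‖X j ω‖) ∂μ ≤ Real.exp ((c * σ) ^ 2 / 2))
    (hy2 : 2 ≤ y) (hyn : y ≤ n) :
    μ.real {ω | σ * √(n * y) ≤ ‖∑ j, (X j ω - ∫ ω', X j ω' ∂μ)‖} ≤ Real.exp (1 / 4 - y / 8) := by
  have hn : (0 : ℝ) < n := by linarith
  have hIx : ∀ j, Integrable (X j) μ := fun j => Integrable.of_bound
    (hm j).aestronglyMeasurable B (Filter.Eventually.of_forall (hB j))
  set z : Fin n → E := fun j => ∫ ω, X j ω ∂μ with hz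
  have hYind : iIndepFun (fun j ω => X j ω - z j) μ :=
    hind.comp (fun j x => x - z j) fun j => by fun_prop
  have hYm : ∀ j, AEMeasurable (fun ω => X j ω - z j) μ := fun j => (hm j).sub_const _
  have hYB : ∀ j ω, ‖X j ω - z j‖ ≤ B + σ := fun j ω =>
    (norm_sub_le _ _).trans (add_le_add (hB j ω) (hmean j))
  have hY0 : ∀ j, ∫ ω, (X j ω - z j) ∂μ = 0 := fun j => by
    rw [integral_sub (hIx j) (integrable_const _)]
    simp [hz]
  have hZm : AEMeasurable (fun ω => ∑ j, (X j ω - z j)) μ :=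
    Finset.aemeasurable_fun_sum _ fun j _ => hYm j
  have hZB : ∀ ω, ‖∑ j, (X j ω - z j)‖ ≤ n * (B + σ) := fun ω =>
    (norm_sum_le_of_le _ fun j _ => hYB j ω).trans (by simp [mul_add])
  rcases le_total y 16 with hy | hy
  -- Moderate y: Chebyshev. Taking c = 1/σ and using 1 + x²/2 ≤ cosh x, the second moment is at most
  -- 2(e^(1/2) - 1)σ² ≤ 1.3 σ²; centering does not increase it.
  · have hX2 : ∀ j, ∫ ω, ‖X j ω‖ ^ 2 ∂μ ≤ 1.3 * σ ^ 2 := fun j => by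
      have h1 := hcosh j (1 / σ) (by positivity)
      have hI2 := integrable_comp_norm_of_bound (hm j) (hB j) (continuous_pow 2)
      have hIc := integrable_comp_norm_of_bound (hm j) (hB j)
        (φ := fun x => Real.cosh (1 / σ * x)) (by fun_prop)
      have h2 : ∫ ω, (1 + ‖X j ω‖ ^ 2 * ((1 / σ) ^ 2 / 2)) ∂μ ≤
          ∫ ω, Real.cosh (1 / σ * ‖X j ω‖) ∂μ :=
        integral_mono ((integrable_const _).add (hI2.mul_const _)) hIc fun ω => by
          refine (Real.one_add_sq_div_two_le_cosh _).trans_eq' ?_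
          ring
      rw [integral_add (integrable_const _) (hI2.mul_const _), integral_mul_const] at h2
      simp only [integral_const, probReal_univ, one_smul] at h2
      have h3 : Real.exp ((1 / σ * σ) ^ 2 / 2) ≤ 1.65 := by
        rw [one_div_mul_cancel hσ.ne']
        have h : Real.exp (1 ^ 2 / 2) ^ 2 ≤ (1.65 : ℝ) ^ 2 := by
          rw [← Real.exp_nat_mul]
          norm_num
          linarith [Real.exp_one_lt_d9]
        exact le_of_pow_le_pow_left₀ two_ne_zero (by norm_num) h
      have h4 : (∫ ω, ‖X j ω‖ ^ 2 ∂μ) * ((1 / σ) ^ 2 / 2) ≤ 0.65 := by linarith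
      rw [one_div, inv_pow, div_eq_mul_inv, ← mul_inv, ← div_eq_mul_inv,
        div_le_iff₀ (by positivity)] at h4
      linarith
    have hY2 : ∀ j, ∫ ω, ‖X j ω - z j‖ ^ 2 ∂μ ≤ 1.3 * σ ^ 2 := fun j => by
      refine le_trans ?_ (hX2 j)
      simp_rw [norm_sub_sq_real, real_inner_comm (z j)]
      have hI2 := integrable_comp_norm_of_bound (hm j) (hB j) (continuous_pow 2)
      have hIi := ((hIx j).const_inner (𝕜 := ℝ) (z j)).const_mul 2
      have hI3 : Integrable (fun ω => ‖X j ω‖ ^ 2 - 2 * ⟪z j, X j ω⟫) μ := hI2.sub hIi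
      rw [integral_add hI3 (integrable_const _), integral_sub hI2 hIi,
        integral_const_mul, integral_inner (hIx j)]
      simp only [integral_const, probReal_univ, one_smul]
      have : ⟪z j, ∫ ω, X j ω ∂μ⟫ = ‖z j‖ ^ 2 := real_inner_self_eq_norm_sq _
      rw [this]
      linarith [sq_nonneg ‖z j‖]
    have hZ2 := integral_sq_norm_sum_le hYind hYm hYB hY0 hY2 Finset.univ
    rw [Finset.card_univ, Fintype.card_fin] at hZ2
    have hmk := mul_meas_ge_le_integral_of_nonneg
      (Filter.Eventually.of_forall fun ω => sq_nonneg ‖∑ j, (X j ω - z j)‖)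
      (integrable_comp_norm_of_bound (μ := μ) hZm hZB (continuous_pow 2)) ((σ * √(n * y)) ^ 2)
    have hset : {ω | σ * √(n * y) ≤ ‖∑ j, (X j ω - z j)‖} =
        {ω | (σ * √(n * y)) ^ 2 ≤ ‖∑ j, (X j ω - z j)‖ ^ 2} := by
      ext ω
      exact (pow_le_pow_iff_left₀ (by positivity) (norm_nonneg _) two_ne_zero).symm
    rw [hset]
    refine le_trans ?_ (chebyshev_le_exp hy2 hy)
    rw [mul_pow, Real.sq_sqrt (by positivity)] at hmk ⊢
    rw [le_div_iff₀ (by linarith)]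
    have hpos : 0 < σ ^ 2 * n := by positivity
    refine le_of_mul_le_mul_left ?_ hpos
    calc _ = σ ^ 2 * (n * y) * μ.real {ω | σ ^ 2 * (n * y) ≤ ‖∑ j, (X j ω - z j)‖ ^ 2} := by ring
      _ ≤ _ := hmk.trans hZ2
      _ = _ := by ring
  -- Large y: Chernoff with cosh. This l maximizes l√(ny) - 3nl²/2: the threshold contributes y/3
  -- and the moment bound y/6. The assumption y ≤ n gives l ≤ 1/3, as `one_add_two_mul_exp_mul_le`
  -- requires.
  · set l := √(y / n) / 3 with hl
    set c := l / σ with hc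
    have hl0 : 0 ≤ l := by positivity
    have hl2 : l ^ 2 = y / n / 9 := by rw [hl, div_pow, Real.sq_sqrt (by positivity)]; norm_num
    have hl1 : l ≤ 1 / 3 := by
      have : √(y / n) ≤ 1 := Real.sqrt_le_one.2 (by rw [div_le_one hn]; exact hyn)
      rw [hl]; linarith
    have hc0 : 0 ≤ c := by positivity
    have hcσ : c * σ = l := by rw [hc]; field_simp
    have hnorm : ∀ v : E, ‖c • v‖ = c * ‖v‖ := fun v => by
      rw [norm_smul, Real.norm_of_nonneg hc0]
    have hψ : ∀ j, ∫ ω, (Real.cosh ‖c • (X j ω - z j)‖ + (Real.sinh ‖c • (X j ω - z j)‖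
        - ‖c • (X j ω - z j)‖)) ∂μ ≤ Real.exp (3 * l ^ 2 / 2) := fun j => by
      have hcm : AEMeasurable (fun ω => c • X j ω) μ := (hm j).const_smul c
      have hcB : ∀ ω, ‖c • X j ω‖ ≤ c * B := fun ω => by rw [hnorm]; gcongr; exact hB j ω
      have h1 := integral_cosh_norm_sub_integral_le hcm hcB
      have h2 := hcosh j c hc0
      rw [hcσ] at h2
      rw [integral_smul] at h1
      simp_rw [← smul_sub, hnorm] at h1 ⊢
      have h3 : c * ‖∫ ω, X j ω ∂μ‖ ≤ l := by rw [← hcσ]; gcongr; exact hmean j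
      have hI := integrable_comp_norm_of_bound (μ := μ) (hYm j) (hYB j)
        (φ := fun x => Real.cosh (c * x)) (by fun_prop)
      have hI' := integrable_comp_norm_of_bound (μ := μ) (hYm j) (hYB j)
        (φ := fun x => Real.cosh (c * x) + (Real.sinh (c * x) - c * x)) (by fun_prop)
      -- Since sinh x - x ≤ cosh x - 1, a bound for the centered cosh moment suffices; doubling it
      -- produces the factor 2 in `one_add_two_mul_exp_mul_le`.
      have h4 : ∫ ω, (Real.cosh (c * ‖X j ω - z j‖) + (Real.sinh (c * ‖X j ω - z j‖)
          - c * ‖X j ω - z j‖)) ∂μ ≤ ∫ ω, (2 * Real.cosh (c * ‖X j ω - z j‖) - 1) ∂μ :=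
        integral_mono hI' ((hI.const_mul 2).sub (integrable_const _)) fun ω => by
          linarith [Real.sinh_sub_self_le (c * ‖X j ω - z j‖)]
      rw [integral_sub (hI.const_mul 2) (integrable_const _), integral_const_mul] at h4
      simp only [integral_const, probReal_univ, one_smul] at h4
      refine (h4.trans ?_).trans (one_add_two_mul_exp_mul_le hl0 hl1)
      have h5 : Real.exp (c * ‖∫ ω, X j ω ∂μ‖) * (∫ ω, Real.cosh (c * ‖X j ω‖) ∂μ - 1) ≤
          Real.exp l * (Real.exp (l ^ 2 / 2) - 1) := by
        refine mul_le_mul (Real.exp_le_exp.2 h3) (by linarith) ?_ (Real.exp_pos _).le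
        have hIX := integrable_comp_norm_of_bound (μ := μ) (hm j) (hB j)
          (φ := fun x => Real.cosh (c * x)) (by fun_prop)
        have := integral_mono (integrable_const (1 : ℝ)) hIX fun ω => Real.one_le_cosh _
        simp only [integral_const, probReal_univ, one_smul] at this
        linarith
      linarith
    have hcind : iIndepFun (fun j ω => c • (X j ω - z j)) μ :=
      hYind.comp (fun j x => c • x) fun j => by fun_prop
    have hZ := integral_cosh_norm_sum_le (B := c * (B + σ)) hcind (fun j => (hYm j).const_smul c)
      (fun j ω => by rw [hnorm]; gcongr; exact hYB j ω)
      (fun j => by rw [integral_smul, hY0, smul_zero]) hψ Finset.univ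
    rw [Finset.card_univ, Fintype.card_fin] at hZ
    simp_rw [← Finset.smul_sum, hnorm] at hZ
    have hmk := mul_meas_ge_le_integral_of_nonneg
      (Filter.Eventually.of_forall fun ω => (Real.cosh_pos (c * ‖∑ j, (X j ω - z j)‖)).le)
      (integrable_comp_norm_of_bound (μ := μ) hZm hZB (φ := fun x => Real.cosh (c * x))
        (by fun_prop)) (Real.cosh (c * (σ * √(n * y))))
    have hcx : c * (σ * √(n * y)) = y / 3 := by
      rw [← mul_assoc, hcσ, hl, div_mul_eq_mul_div, ← Real.sqrt_mul (by positivity)]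
      have : y / n * (n * y) = y ^ 2 := by field_simp
      rw [this, Real.sqrt_sq (by linarith)]
    have hsub : {ω | σ * √(n * y) ≤ ‖∑ j, (X j ω - z j)‖} ⊆
        {ω | Real.cosh (c * (σ * √(n * y))) ≤ Real.cosh (c * ‖∑ j, (X j ω - z j)‖)} := by
      intro ω hω
      change σ * √(n * y) ≤ ‖∑ j, (X j ω - z j)‖ at hω
      change Real.cosh _ ≤ Real.cosh _
      rw [Real.cosh_le_cosh, abs_of_nonneg (by positivity), abs_of_nonneg (by positivity)]
      gcongr
    refine (measureReal_mono hsub).trans (le_trans ?_ (two_mul_exp_le_of_sixteen_le hy))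
    have hpow : Real.exp (3 * l ^ 2 / 2) ^ n = Real.exp (y / 6) := by
      rw [← Real.exp_nat_mul, hl2]
      congr 1
      field_simp
      norm_num
    rw [hpow] at hZ
    rw [hcx] at hmk ⊢
    have hch : Real.exp (y / 3) / 2 ≤ Real.cosh (y / 3) := by
      rw [Real.cosh_eq]; linarith [Real.exp_pos (-(y / 3))]
    set p := μ.real {ω | Real.cosh (y / 3) ≤ Real.cosh (c * ‖∑ j, (X j ω - z j)‖)}
    have hp : 0 ≤ p := measureReal_nonneg
    have h6 : Real.exp (y / 3) / 2 * p ≤ Real.exp (y / 6) :=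
      (mul_le_mul_of_nonneg_right hch hp).trans (hmk.trans hZ)
    have h7 : Real.exp (y / 3) = Real.exp (y / 6) * Real.exp (y / 6) := by
      rw [← Real.exp_add]; ring_nf
    rw [Real.exp_neg]
    have h8 := Real.exp_pos (y / 6)
    rw [← div_eq_mul_inv, le_div_iff₀ h8]
    rw [h7] at h6
    nlinarith

end

/-! ### Tail sums for the bias, and Hoeffding's inequality -/

lemma Real.sqrt_le_half_div_add {x c : ℝ} (hx : 0 ≤ x) (hc : 0 < c) :
    √x ≤ (x / c + c) / 2 := by
  rw [div_add' _ _ _ hc.ne', div_div, le_div_iff₀ (by positivity)]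
  nlinarith [sq_nonneg (√x - c), Real.sq_sqrt hx]

/-- The summand is the tangent majorant of Mg √(t+1), with t = k + H, taken at c² = 1/(1-γ) + H.
This is the mean of t + 1 under the normalized weights γ^t on t ≥ H, so the two halves of the
majorant average to c/2 each. -/
lemma hasSum_biasGrad {γ : ℝ} (h0 : 0 ≤ γ) (h1 : γ < 1) (Mg : ℝ) (H : ℕ) :
    HasSum (fun k : ℕ => γ ^ (k + H) * (Mg * (((((k + H : ℕ) : ℝ) + 1) / √(1 / (1 - γ) + H)
      + √(1 / (1 - γ) + H)) / 2))) (biasGrad γ Mg H) := by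
  have h2 : 0 < 1 - γ := by linarith
  have hq : 0 < 1 / (1 - γ) + (H : ℝ) := by positivity
  set c := √(1 / (1 - γ) + H) with hc
  have hc0 : 0 < c := Real.sqrt_pos.2 hq
  have hc2 : c ^ 2 = 1 / (1 - γ) + H := Real.sq_sqrt hq.le
  have hA := (hasSum_geometric_mul_succ h0 h1).mul_left (γ ^ H * Mg / (2 * c))
  have hB := (hasSum_geometric_of_lt_one h0 h1).mul_left
    (γ ^ H * Mg * (H / (2 * c) + c / 2))
  have hval : biasGrad γ Mg H = γ ^ H * Mg / (2 * c) * (1 / (1 - γ) ^ 2)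
      + γ ^ H * Mg * (H / (2 * c) + c / 2) * (1 - γ)⁻¹ := by
    have e : 1 / (1 - γ) ^ 2 = (c ^ 2 - H) / (1 - γ) := by
      rw [hc2]; field_simp; ring
    rw [biasGrad, ← hc, e]
    field_simp
    ring
  have hfun : (fun k : ℕ => γ ^ (k + H) * (Mg * (((((k + H : ℕ) : ℝ) + 1) / c + c) / 2))) =
      fun k : ℕ => γ ^ H * Mg / (2 * c) * (γ ^ k * ((k : ℝ) + 1))
        + γ ^ H * Mg * (H / (2 * c) + c / 2) * γ ^ k := by
    ext k
    push_cast
    rw [pow_add]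
    field_simp
    ring
  rw [hfun, hval]
  exact hA.add hB

lemma norm_sub_sum_range_le {F : Type*} [NormedAddCommGroup F] [NormedSpace ℝ F]
    {f : ℕ → F} {g : ℕ → ℝ} {a : F} {b : ℝ} {H : ℕ} (hf : HasSum f a)
    (hg : HasSum (fun k => g (k + H)) b) (hfg : ∀ t, ‖f t‖ ≤ g t) :
    ‖a - ∑ t ∈ Finset.range H, f t‖ ≤ b := by
  rw [← ((hasSum_nat_add_iff' H).2 hf).tsum_eq]
  exact tsum_of_norm_bounded hg fun k => hfg (k + H)

lemma one_sub_le_measureReal {Ω : Type*} [MeasurableSpace Ω] {μ : Measure Ω}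
    [IsProbabilityMeasure μ] {s t : Set Ω} {δ : ℝ} (h : μ.real t ≤ δ) (hst : sᶜ ⊆ t) :
    1 - δ ≤ μ.real s := by
  have h1 : μ.real (s ∪ t) = 1 := by
    have : s ∪ t = Set.univ := Set.eq_univ_of_forall fun ω =>
      (Classical.em (ω ∈ s)).imp id fun hω => hst hω
    rw [this, probReal_univ]
  linarith [measureReal_union_le (μ := μ) s t]

/-- Two-sided Hoeffding inequality for the mean of independent bounded random variables. -/
lemma one_sub_le_measureReal_abs_mean_sub_le {Ω : Type*} [MeasurableSpace Ω] {μ : Measure Ω}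
    [IsProbabilityMeasure μ] {n : ℕ} (hn : 0 < n) {X : Fin n → Ω → ℝ} {B δ : ℝ}
    (hind : iIndepFun X μ) (hm : ∀ j, AEMeasurable (X j) μ) (hB : 0 < B)
    (hXB : ∀ j ω, |X j ω| ≤ B) (hδ : 0 < δ) (hδ1 : δ < 1) :
    1 - δ ≤ μ.real {ω | |∑ j, (X j ω - ∫ ω', X j ω' ∂μ)| ≤ √2 * B * √n * √(Real.log (2 / δ))} := by
  have hn' : (0 : ℝ) < n := Nat.cast_pos.2 hn
  set L := Real.log (2 / δ) with hL
  have hL0 : 0 ≤ L := Real.log_nonneg (by rw [le_div_iff₀ hδ]; linarith)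
  set ε := √2 * B * √n * √L with hε
  have hε0 : 0 ≤ ε := by positivity
  have hsub : ∀ j, HasSubgaussianMGF (fun ω => X j ω - ∫ ω', X j ω' ∂μ)
      ((‖B - -B‖₊ / 2) ^ 2) μ := fun j =>
    hasSubgaussianMGF_of_mem_Icc (hm j)
      (Filter.Eventually.of_forall fun ω => abs_le.1 (hXB j ω))
  have hind1 : iIndepFun (fun j ω => X j ω - ∫ ω', X j ω' ∂μ) μ :=
    hind.comp (fun j x => x - ∫ ω', X j ω' ∂μ) fun j => by fun_prop
  have hind2 : iIndepFun (fun j ω => -(X j ω - ∫ ω', X j ω' ∂μ)) μ :=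
    hind1.comp (fun j x => -x) fun j => by fun_prop
  -- A variable in [-B, B] has variance proxy B², so ε makes the exponent equal to -log(2/δ); each
  -- of the two tails then has mass at most δ/2.
  have hcoef : Real.exp (-ε ^ 2 / (2 * ((∑ _j : Fin n, (‖B - -B‖₊ / 2) ^ 2 : NNReal) : ℝ))) =
      δ / 2 := by
    have h1 : ((∑ _j : Fin n, (‖B - -B‖₊ / 2) ^ 2 : NNReal) : ℝ) = n * B ^ 2 := by
      push_cast
      rw [Finset.sum_const, Finset.card_univ, Fintype.card_fin, Real.norm_of_nonneg (by linarith),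
        nsmul_eq_mul]
      ring
    have h2 : ε ^ 2 = 2 * B ^ 2 * n * L := by
      rw [hε]
      simp only [mul_pow]
      rw [Real.sq_sqrt two_pos.le, Real.sq_sqrt hn'.le, Real.sq_sqrt hL0]
    rw [h1, h2, show -(2 * B ^ 2 * n * L) / (2 * (n * B ^ 2)) = -L by field_simp, hL,
      Real.exp_neg, Real.exp_log (by positivity), inv_div]
  have hp1 := HasSubgaussianMGF.measure_sum_ge_le_of_iIndepFun hind1 (s := Finset.univ)
    (fun j _ => hsub j) hε0
  have hp2 := HasSubgaussianMGF.measure_sum_ge_le_of_iIndepFun hind2 (s := Finset.univ)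
    (fun j _ => (hsub j).neg) hε0
  rw [hcoef] at hp1 hp2
  refine one_sub_le_measureReal
    (t := {ω | ε ≤ ∑ j, (X j ω - ∫ ω', X j ω' ∂μ)} ∪
      {ω | ε ≤ ∑ j, -(X j ω - ∫ ω', X j ω' ∂μ)})
    ((measureReal_union_le _ _).trans (by linarith)) fun ω hω => ?_
  have hω' : ε < |∑ j, (X j ω - ∫ ω', X j ω' ∂μ)| := not_le.1 hω
  rcases lt_abs.1 hω' with h | h
  · exact Or.inl h.le
  · refine Or.inr ?_
    change ε ≤ ∑ j, -(X j ω - ∫ ω', X j ω' ∂μ)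
    rw [Finset.sum_neg_distrib]
    exact h.le

/-! ### Expectation and concentration of the two estimators -/

section

variable {S A : Type*} [MeasurableSpace S] [MeasurableSpace A] {m d : ℕ} {ν : Measure A} [SFinite ν]

namespace CMDP

variable (M : CMDP S A m)

/-- The discounted reward of a truncated trajectory. -/
noncomputable def trajValue (i : Fin (m + 1)) {H : ℕ} (x : Fin H → S × A) : ℝ :=
  ∑ t : Fin H, M.γ ^ (t : ℕ) * M.r i (x t)

/-- The policy gradient estimator of a single truncated trajectory. -/
noncomputable def trajGrad (π : PolicyFamily S A d ν) (i : Fin (m + 1))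
    (θ : EuclideanSpace ℝ (Fin d)) {H : ℕ} (x : Fin H → S × A) : EuclideanSpace ℝ (Fin d) :=
  ∑ t : Fin H, ∑ t' ∈ Finset.Iic t,
    (M.γ ^ (t : ℕ) * M.r i (x t)) • π.score θ (x t').1 (x t').2

lemma valueEst_eq (i : Fin (m + 1)) {n H : ℕ} (τ : Fin n → Fin H → S × A) :
    M.valueEst i τ = (1 / (n : ℝ)) * ∑ j, M.trajValue i (τ j) := rfl

lemma gradEst_eq (π : PolicyFamily S A d ν) (i : Fin (m + 1)) (θ : EuclideanSpace ℝ (Fin d))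
    {n H : ℕ} (τ : Fin n → Fin H → S × A) :
    M.gradEst π i θ τ = (1 / (n : ℝ)) • ∑ j, M.trajGrad π i θ (τ j) := rfl

lemma measurable_trajValue (i : Fin (m + 1)) {H : ℕ} :
    Measurable (M.trajValue i (H := H)) :=
  Finset.measurable_fun_sum _ fun t _ =>
    ((M.measurable_r i).comp (measurable_pi_apply t)).const_mul _

lemma abs_trajValue_le (i : Fin (m + 1)) {H : ℕ} (x : Fin H → S × A) :
    |M.trajValue i x| ≤ 1 / (1 - M.γ) := by
  have hg := hasSum_geometric_of_lt_one M.γ_pos.le M.γ_lt_one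
  calc |M.trajValue i x| ≤ ∑ t : Fin H, |M.γ ^ (t : ℕ) * M.r i (x t)| :=
        Finset.abs_sum_le_sum_abs _ _
    _ ≤ ∑ t : Fin H, M.γ ^ (t : ℕ) := Finset.sum_le_sum fun t _ => by
        rw [abs_mul, abs_of_nonneg (pow_nonneg M.γ_pos.le _)]
        exact mul_le_of_le_one_right (pow_nonneg M.γ_pos.le _) (M.abs_r_le i _)
    _ = ∑ t ∈ Finset.range H, M.γ ^ t := Fin.sum_univ_eq_sum_range (fun t => M.γ ^ t) H
    _ ≤ (1 - M.γ)⁻¹ := sum_le_hasSum _ (fun t _ => pow_nonneg M.γ_pos.le t) hg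
    _ = _ := (one_div _).symm

lemma integral_truncLaw {F : Type*} [NormedAddCommGroup F] [NormedSpace ℝ F]
    (π : PolicyFamily S A d ν) (θ : EuclideanSpace ℝ (Fin d)) {H : ℕ}
    {f : (Fin H → S × A) → F} (hf : StronglyMeasurable f) :
    ∫ x, f x ∂M.truncLaw π θ H = ∫ τ, f (fun t : Fin H => τ t) ∂M.trajLaw π θ :=
  integral_map (measurable_pi_iff.2 fun t : Fin H => measurable_pi_apply (t : ℕ)).aemeasurable
    hf.aestronglyMeasurable

lemma integral_trajValue (π : PolicyFamily S A d ν) (θ : EuclideanSpace ℝ (Fin d))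
    (i : Fin (m + 1)) (H : ℕ) :
    ∫ x, M.trajValue i x ∂M.truncLaw π θ H =
      ∑ t ∈ Finset.range H, M.γ ^ t * M.expReward π i t θ := by
  rw [M.integral_truncLaw π θ (M.measurable_trajValue i).stronglyMeasurable]
  simp only [trajValue]
  simp_rw [fun τ : ℕ → S × A => Fin.sum_univ_eq_sum_range (fun t => M.γ ^ t * M.r i (τ t)) H]
  rw [integral_finsetSum]
  · simp_rw [integral_const_mul]; rfl
  · intro t _
    refine Integrable.const_mul ?_ _
    exact Integrable.of_bound (M.measurable_r_eval i t).aestronglyMeasurable 1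
      (Filter.Eventually.of_forall fun τ => M.abs_r_le i _)

variable {π : PolicyFamily S A d ν} {U : Set (EuclideanSpace ℝ (Fin d))} {Mg Mh : ℝ}
  {θ : EuclideanSpace ℝ (Fin d)}

lemma trajGrad_restrict (i : Fin (m + 1)) (H : ℕ) (τ : ℕ → S × A) :
    M.trajGrad π i θ (fun t : Fin H => τ t) =
      ∑ t ∈ Finset.range H, M.γ ^ t • (M.r i (τ t) • π.scoreSum θ t τ) := by
  rw [← Fin.sum_univ_eq_sum_range
    (fun t => M.γ ^ t • (M.r i (τ t) • π.scoreSum θ t τ)) H]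
  refine Finset.sum_congr rfl fun t _ => ?_
  rw [smul_smul, PolicyFamily.scoreSum, Finset.smul_sum, Nat.range_succ_eq_Iic,
    ← Fin.map_valEmbedding_Iic, Finset.sum_map]
  rfl

lemma measurable_trajGrad (hπ : π.BoundedScore U Mg Mh) (hU : IsOpen U) (hθ : θ ∈ U)
    (i : Fin (m + 1)) {H : ℕ} : Measurable (M.trajGrad π i θ (H := H)) :=
  Finset.measurable_fun_sum _ fun t _ => Finset.measurable_fun_sum _ fun t' _ =>
    (((M.measurable_r i).comp (measurable_pi_apply t)).const_mul _).smul
      ((hπ.measurable_score hU hθ).comp (measurable_pi_apply t'))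

lemma norm_trajGrad_le (hπ : π.BoundedScore U Mg Mh) (hθ : θ ∈ U) (i : Fin (m + 1)) {H : ℕ}
    (x : Fin H → S × A) :
    ‖M.trajGrad π i θ x‖ ≤ ∑ t : Fin H, ∑ _t' ∈ Finset.Iic t, Mg := by
  refine norm_sum_le_of_le _ fun t _ => norm_sum_le_of_le _ fun t' _ => ?_
  rw [norm_smul, norm_mul, Real.norm_of_nonneg (pow_nonneg M.γ_pos.le _)]
  have h1 : M.γ ^ (t : ℕ) * ‖M.r i (x t)‖ ≤ 1 :=
    mul_le_one₀ (pow_le_one₀ M.γ_pos.le M.γ_lt_one.le) (norm_nonneg _) (M.abs_r_le i _)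
  exact (mul_le_of_le_one_left (norm_nonneg _) h1).trans (hπ.norm_score_le θ hθ _ _)

lemma integral_trajGrad (hπ : π.BoundedScore U Mg Mh) (hU : IsOpen U) (hθ : θ ∈ U)
    (i : Fin (m + 1)) (H : ℕ) :
    ∫ x, M.trajGrad π i θ x ∂M.truncLaw π θ H =
      ∑ t ∈ Finset.range H, M.γ ^ t • M.rewardGrad π i t θ := by
  rw [M.integral_truncLaw π θ (M.measurable_trajGrad hπ hU hθ i).stronglyMeasurable]
  have hI : ∀ t ∈ Finset.range H, Integrable
      (fun τ : ℕ → S × A => M.γ ^ t • (M.r i (τ t) • π.scoreSum θ t τ)) (M.trajLaw π θ) :=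
    fun t _ => (M.integrable_r_smul_scoreSum hπ hU hθ i t).fun_smul (M.γ ^ t)
  simp_rw [trajGrad_restrict]
  rw [integral_finsetSum _ hI]
  exact Finset.sum_congr rfl fun t _ => integral_smul _ _

lemma norm_pow_smul_rewardGrad_le_sqrt (hMg : 0 < Mg) (hπ : π.BoundedScore U Mg Mh)
    (hU : IsOpen U) (hθ : θ ∈ U) (i : Fin (m + 1)) (t : ℕ) :
    ‖M.γ ^ t • M.rewardGrad π i t θ‖ ≤ M.γ ^ t * (Mg * √(t + 1)) := by
  rw [norm_smul, Real.norm_of_nonneg (pow_nonneg M.γ_pos.le t)]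
  exact mul_le_mul_of_nonneg_left (M.norm_rewardGrad_le hMg hπ hU hθ i t)
    (pow_nonneg M.γ_pos.le t)

lemma bias_value_le (π : PolicyFamily S A d ν) (θ : EuclideanSpace ℝ (Fin d)) (i : Fin (m + 1))
    (H : ℕ) :
    |M.value π i θ - ∑ t ∈ Finset.range H, M.γ ^ t * M.expReward π i t θ| ≤
      biasValue M.γ H := by
  have hg := (hasSum_geometric_of_lt_one M.γ_pos.le M.γ_lt_one).mul_right (M.γ ^ H)
  refine norm_sub_sum_range_le (g := fun t => M.γ ^ t) (M.value_eq_tsum π i θ) ?_ fun t => ?_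
  · simp_rw [pow_add]
    rw [biasValue, div_eq_inv_mul]
    exact hg
  · rw [norm_mul, Real.norm_of_nonneg (pow_nonneg M.γ_pos.le t)]
    refine mul_le_of_le_one_right (pow_nonneg M.γ_pos.le t) ?_
    have := norm_integral_le_of_norm_le_const (μ := M.trajLaw π θ) (C := 1)
      (f := fun τ : ℕ → S × A => M.r i (τ t))
      (Filter.Eventually.of_forall fun τ => M.abs_r_le i _)
    rw [probReal_univ, mul_one] at this
    exact this

lemma bias_grad_le (hMg : 0 < Mg) (hπ : π.BoundedScore U Mg Mh) (hU : IsOpen U) (hθ : θ ∈ U)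
    (i : Fin (m + 1)) (H : ℕ) :
    ‖gradient (M.value π i) θ - ∑ t ∈ Finset.range H, M.γ ^ t • M.rewardGrad π i t θ‖ ≤
      biasGrad M.γ Mg H := by
  rw [(M.hasGradientAt_value hMg hπ hU hθ i).gradient]
  have h2 : 0 < 1 - M.γ := by linarith [M.γ_lt_one]
  refine norm_sub_sum_range_le (g := fun t => M.γ ^ t * (Mg * ((((t : ℝ) + 1) /
    √(1 / (1 - M.γ) + H) + √(1 / (1 - M.γ) + H)) / 2)))
    (M.summable_rewardGrad hMg hπ hU hθ i).hasSum (hasSum_biasGrad M.γ_pos.le M.γ_lt_one Mg H)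
    fun t => (M.norm_pow_smul_rewardGrad_le_sqrt hMg hπ hU hθ i t).trans ?_
  have := M.γ_pos
  gcongr
  exact Real.sqrt_le_half_div_add (by positivity) (by positivity)

/-- The case H = 0, Mg = 1 of the tangent bound for the bias; it is the source of the exponent 3/2
in the scale of the gradient estimator. -/
lemma sum_pow_mul_sqrt_le (H : ℕ) :
    ∑ t ∈ Finset.range H, M.γ ^ t * √((t : ℝ) + 1) ≤ 1 / (1 - M.γ) ^ (3 / 2 : ℝ) := by
  have h2 : 0 < 1 - M.γ := by linarith [M.γ_lt_one]
  have h3 : biasGrad M.γ 1 0 = 1 / (1 - M.γ) ^ (3 / 2 : ℝ) := by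
    have h4 : (1 - M.γ) ^ (3 / 2 : ℝ) = (1 - M.γ) * √(1 - M.γ) := by
      rw [Real.sqrt_eq_rpow, show (3 / 2 : ℝ) = 1 + 1 / 2 by norm_num, Real.rpow_add h2,
        Real.rpow_one]
    rw [biasGrad, h4]
    simp only [pow_zero, mul_one, Nat.cast_zero, add_zero]
    rw [Real.sqrt_div zero_le_one, Real.sqrt_one, div_mul_div_comm, one_mul]
  rw [← h3]
  have hs := hasSum_biasGrad M.γ_pos.le M.γ_lt_one 1 0
  have hγ := M.γ_pos
  refine (Finset.sum_le_sum fun t _ => ?_).trans (sum_le_hasSum (Finset.range H)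
    (fun t _ => by positivity) hs)
  simp only [add_zero, one_mul, Nat.cast_zero]
  gcongr
  exact Real.sqrt_le_half_div_add (by positivity) (by positivity)

lemma norm_integral_trajGrad_le (hMg : 0 < Mg) (hπ : π.BoundedScore U Mg Mh) (hU : IsOpen U)
    (hθ : θ ∈ U) (i : Fin (m + 1)) (H : ℕ) :
    ‖∫ x, M.trajGrad π i θ x ∂M.truncLaw π θ H‖ ≤ Mg / (1 - M.γ) ^ (3 / 2 : ℝ) := by
  rw [M.integral_trajGrad hπ hU hθ i H]
  refine (norm_sum_le_of_le _ fun t _ =>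
    M.norm_pow_smul_rewardGrad_le_sqrt hMg hπ hU hθ i t).trans ?_
  calc _ = Mg * ∑ t ∈ Finset.range H, M.γ ^ t * √((t : ℝ) + 1) := by
        rw [Finset.mul_sum]; exact Finset.sum_congr rfl fun t _ => by ring
    _ ≤ Mg * (1 / (1 - M.γ) ^ (3 / 2 : ℝ)) := by gcongr; exact M.sum_pow_mul_sqrt_le H
    _ = _ := mul_one_div _ _

/-- Jensen for cosh with weights proportional to γ^t √(t+1). The arguments are then c a
‖S_t‖/√(t+1), with a the sum of these weights, and since ‖S_t‖ has sub-Gaussian scale Mg √(t+1)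
every term receives the same bound exp((c Mg a)²/2). -/
lemma integral_cosh_trajGrad_le (hMg : 0 < Mg) (hπ : π.BoundedScore U Mg Mh) (hU : IsOpen U)
    (hθ : θ ∈ U) (i : Fin (m + 1)) (H : ℕ) {c : ℝ} (hc : 0 ≤ c) :
    ∫ x, Real.cosh (c * ‖M.trajGrad π i θ x‖) ∂M.truncLaw π θ H ≤
      Real.exp ((c * (Mg / (1 - M.γ) ^ (3 / 2 : ℝ))) ^ 2 / 2) := by
  have hγ := M.γ_pos
  have h2 : 0 < 1 - M.γ := by linarith [M.γ_lt_one]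
  rw [M.integral_truncLaw π θ (f := fun x => Real.cosh (c * ‖M.trajGrad π i θ x‖)) (Real.measurable_cosh.comp
    ((M.measurable_trajGrad hπ hU hθ i).norm.const_mul c)).stronglyMeasurable]
  simp_rw [trajGrad_restrict]
  -- For H = 0 the normalizing constant a would vanish.
  rcases Nat.eq_zero_or_pos H with rfl | hH
  · simp only [Finset.range_zero, Finset.sum_empty, norm_zero, mul_zero, Real.cosh_zero,
      integral_const, probReal_univ, one_smul]
    exact Real.one_le_exp (by positivity)
  set a := ∑ t ∈ Finset.range H, M.γ ^ t * √((t : ℝ) + 1) with ha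
  have ha0 : 0 < a := Finset.sum_pos (fun t _ => by positivity)
    (Finset.nonempty_range_iff.2 hH.ne')
  have ha1 : a ≤ 1 / (1 - M.γ) ^ (3 / 2 : ℝ) := M.sum_pow_mul_sqrt_le H
  let w : ℕ → ℝ := fun t => M.γ ^ t * √((t : ℝ) + 1) / a
  let q : ℕ → ℝ := fun t => c * a / √((t : ℝ) + 1)
  have hw0 : ∀ t ∈ Finset.range H, 0 ≤ w t := fun t _ => by positivity
  have hq0 : ∀ t, 0 ≤ q t := fun t => by positivity
  have hw1 : ∑ t ∈ Finset.range H, w t = 1 := by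
    rw [← Finset.sum_div, div_self ha0.ne']
  have hpt : ∀ τ : ℕ → S × A,
      Real.cosh (c * ‖∑ t ∈ Finset.range H, M.γ ^ t • (M.r i (τ t) • π.scoreSum θ t τ)‖) ≤
        ∑ t ∈ Finset.range H, w t * Real.cosh (q t * ‖π.scoreSum θ t τ‖) := by
    intro τ
    refine le_trans ?_ (Real.convexOn_cosh.map_sum_le hw0 hw1
      (p := fun t => q t * ‖π.scoreSum θ t τ‖) (fun t _ => Set.mem_univ _))
    have hsum : c * ‖∑ t ∈ Finset.range H, M.γ ^ t • (M.r i (τ t) • π.scoreSum θ t τ)‖ ≤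
        ∑ t ∈ Finset.range H, w t • (q t * ‖π.scoreSum θ t τ‖) := by
      calc _ ≤ c * ∑ t ∈ Finset.range H, M.γ ^ t * ‖π.scoreSum θ t τ‖ := by
            refine mul_le_mul_of_nonneg_left (norm_sum_le_of_le _ fun t _ => ?_) hc
            rw [norm_smul, norm_smul, Real.norm_of_nonneg (pow_nonneg hγ.le t)]
            exact mul_le_mul_of_nonneg_left
              (mul_le_of_le_one_left (norm_nonneg _) (M.abs_r_le i _)) (pow_nonneg hγ.le t)
        _ = _ := by
            rw [Finset.mul_sum]
            refine Finset.sum_congr rfl fun t _ => ?_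
            have : 0 < √((t : ℝ) + 1) := by positivity
            simp only [w, q, smul_eq_mul]
            field_simp
    rw [Real.cosh_le_cosh, abs_of_nonneg (by positivity), abs_of_nonneg]
    · exact hsum
    · exact le_trans (by positivity) hsum
  have hI : ∀ t, Integrable (fun τ => Real.cosh (q t * ‖π.scoreSum θ t τ‖)) (M.trajLaw π θ) :=
    fun t => integrable_comp_norm_of_bound (hπ.measurable_scoreSum hU hθ t).aemeasurable
      (hπ.norm_scoreSum_le hθ t) (φ := fun x => Real.cosh (q t * x)) (by fun_prop)
  have hterm : ∀ t, ∫ τ, Real.cosh (q t * ‖π.scoreSum θ t τ‖) ∂M.trajLaw π θ ≤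
      Real.exp ((c * (Mg / (1 - M.γ) ^ (3 / 2 : ℝ))) ^ 2 / 2) := fun t => by
    refine (M.integral_cosh_scoreSum_le hπ hU hθ (hq0 t) t).trans ?_
    calc Real.cosh (q t * Mg) ^ (t + 1) ≤ Real.exp ((q t * Mg) ^ 2 / 2) ^ (t + 1) :=
          pow_le_pow_left₀ (Real.cosh_pos _).le (Real.cosh_le_exp_half_sq _) _
      _ = Real.exp ((c * (Mg * a)) ^ 2 / 2) := by
          rw [← Real.exp_nat_mul]
          congr 1
          simp only [q]
          rw [mul_pow (_ / _), div_pow, Real.sq_sqrt (by positivity)]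
          push_cast
          field_simp
      _ ≤ _ := by
          rw [Real.exp_le_exp, ← mul_one_div Mg]
          gcongr
  calc _ ≤ ∫ τ, ∑ t ∈ Finset.range H, w t * Real.cosh (q t * ‖π.scoreSum θ t τ‖)
          ∂M.trajLaw π θ :=
        integral_mono_of_nonneg (Filter.Eventually.of_forall fun τ => (Real.cosh_pos _).le)
          (integrable_finsetSum _ fun t _ => (hI t).const_mul _) (Filter.Eventually.of_forall hpt)
    _ = ∑ t ∈ Finset.range H,
          w t * ∫ τ, Real.cosh (q t * ‖π.scoreSum θ t τ‖) ∂M.trajLaw π θ := by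
        rw [integral_finsetSum _ fun t _ => (hI t).const_mul _]
        simp_rw [integral_const_mul]
    _ ≤ ∑ t ∈ Finset.range H,
          w t * Real.exp ((c * (Mg / (1 - M.γ) ^ (3 / 2 : ℝ))) ^ 2 / 2) :=
        Finset.sum_le_sum fun t ht => mul_le_mul_of_nonneg_left (hterm t) (hw0 t ht)
    _ = _ := by rw [← Finset.sum_mul, hw1, one_mul]

variable {Ω : Type*} [MeasurableSpace Ω] {Pr : Measure Ω} [IsProbabilityMeasure Pr] {n H : ℕ}
  {τ : Fin n → Ω → (Fin H → S × A)}

lemma integrable_trajValue (hτ : ∀ j, HasLaw (τ j) (M.truncLaw π θ H) Pr) (i : Fin (m + 1))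
    (j : Fin n) : Integrable (fun ω => M.trajValue i (τ j ω)) Pr :=
  Integrable.of_bound
    ((M.measurable_trajValue i).comp_aemeasurable (hτ j).aemeasurable).aestronglyMeasurable
    (1 / (1 - M.γ)) (Filter.Eventually.of_forall fun _ => M.abs_trajValue_le i _)

lemma integral_valueEst (hn : 0 < n) (hτ : ∀ j, HasLaw (τ j) (M.truncLaw π θ H) Pr)
    (i : Fin (m + 1)) :
    ∫ ω, M.valueEst i (fun j => τ j ω) ∂Pr =
      ∑ t ∈ Finset.range H, M.γ ^ t * M.expReward π i t θ := by
  have hn' : (n : ℝ) ≠ 0 := Nat.cast_ne_zero.2 hn.ne'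
  simp_rw [valueEst_eq]
  rw [integral_const_mul, integral_finsetSum _ fun j _ => M.integrable_trajValue hτ i j]
  have h : ∀ j, ∫ ω, M.trajValue i (τ j ω) ∂Pr =
      ∑ t ∈ Finset.range H, M.γ ^ t * M.expReward π i t θ := fun j => by
    rw [← M.integral_trajValue]
    exact (hτ j).integral_comp (M.measurable_trajValue i).aestronglyMeasurable
  simp_rw [h]
  rw [Finset.sum_const, Finset.card_univ, Fintype.card_fin, nsmul_eq_mul]
  field_simp

lemma integrable_trajGrad (hπ : π.BoundedScore U Mg Mh) (hU : IsOpen U) (hθ : θ ∈ U)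
    (hτ : ∀ j, HasLaw (τ j) (M.truncLaw π θ H) Pr) (i : Fin (m + 1)) (j : Fin n) :
    Integrable (fun ω => M.trajGrad π i θ (τ j ω)) Pr :=
  Integrable.of_bound
    ((M.measurable_trajGrad hπ hU hθ i).comp_aemeasurable (hτ j).aemeasurable).aestronglyMeasurable
    _ (Filter.Eventually.of_forall fun _ => M.norm_trajGrad_le hπ hθ i _)

lemma integral_gradEst (hn : 0 < n) (hπ : π.BoundedScore U Mg Mh) (hU : IsOpen U) (hθ : θ ∈ U)
    (hτ : ∀ j, HasLaw (τ j) (M.truncLaw π θ H) Pr) (i : Fin (m + 1)) :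
    ∫ ω, M.gradEst π i θ (fun j => τ j ω) ∂Pr =
      ∑ t ∈ Finset.range H, M.γ ^ t • M.rewardGrad π i t θ := by
  have hn' : (n : ℝ) ≠ 0 := Nat.cast_ne_zero.2 hn.ne'
  simp_rw [gradEst_eq]
  rw [integral_smul, integral_finsetSum _ fun j _ => M.integrable_trajGrad hπ hU hθ hτ i j]
  have h : ∀ j, ∫ ω, M.trajGrad π i θ (τ j ω) ∂Pr =
      ∑ t ∈ Finset.range H, M.γ ^ t • M.rewardGrad π i t θ := fun j => by
    rw [← M.integral_trajGrad hπ hU hθ]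
    exact (hτ j).integral_comp (M.measurable_trajGrad hπ hU hθ i).aestronglyMeasurable
  simp_rw [h]
  rw [Finset.sum_const, Finset.card_univ, Fintype.card_fin, ← Nat.cast_smul_eq_nsmul ℝ,
    smul_smul, one_div_mul_cancel hn', one_smul]

lemma valueEst_tail (hn : 0 < n) (hind : iIndepFun τ Pr)
    (hτ : ∀ j, HasLaw (τ j) (M.truncLaw π θ H) Pr) (i : Fin (m + 1)) {δ : ℝ} (hδ : 0 < δ)
    (hδ1 : δ < 1) :
    1 - δ ≤ Pr.real {ω | |M.valueEst i (fun j => τ j ω)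
        - ∫ ω', M.valueEst i (fun j => τ j ω') ∂Pr| ≤
      scaleValue M.γ n * √(Real.log (2 / δ))} := by
  have hn' : (0 : ℝ) < n := Nat.cast_pos.2 hn
  have h2 : 0 < 1 - M.γ := by linarith [M.γ_lt_one]
  refine (one_sub_le_measureReal_abs_mean_sub_le hn (X := fun j ω => M.trajValue i (τ j ω))
    (B := 1 / (1 - M.γ)) (hind.comp (fun _ => M.trajValue i) fun _ => M.measurable_trajValue i)
    (fun j => (M.measurable_trajValue i).comp_aemeasurable (hτ j).aemeasurable) (by positivity)
    (fun j ω => M.abs_trajValue_le i _) hδ hδ1).trans (measureReal_mono fun ω hω => ?_)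
  change |∑ j, (M.trajValue i (τ j ω) - ∫ ω', M.trajValue i (τ j ω') ∂Pr)| ≤ _ at hω
  change |M.valueEst i (fun j => τ j ω) - ∫ ω', M.valueEst i (fun j => τ j ω') ∂Pr| ≤ _
  simp_rw [valueEst_eq]
  rw [integral_const_mul, integral_finsetSum _ fun j _ => M.integrable_trajValue hτ i j,
    ← mul_sub, ← Finset.sum_sub_distrib, abs_mul, abs_of_pos (by positivity)]
  refine (mul_le_mul_of_nonneg_left hω (by positivity)).trans_eq ?_
  rw [scaleValue]
  nth_rewrite 1 [← Real.mul_self_sqrt hn'.le]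
  have : 0 < √(n : ℝ) := by positivity
  field_simp

lemma gradEst_tail (hMg : 0 < Mg) (hπ : π.BoundedScore U Mg Mh) (hU : IsOpen U) (hθ : θ ∈ U)
    (hn : 0 < n) (hind : iIndepFun τ Pr) (hτ : ∀ j, HasLaw (τ j) (M.truncLaw π θ H) Pr)
    (i : Fin (m + 1)) {δ : ℝ} (hδ : 0 < δ) (hδ1 : δ < 1)
    (hnδ : 8 * Real.log (Real.exp (1 / 4) / δ) ≤ n) :
    1 - δ ≤ Pr.real {ω | ‖M.gradEst π i θ (fun j => τ j ω)
        - ∫ ω', M.gradEst π i θ (fun j => τ j ω') ∂Pr‖ ≤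
      scaleGrad M.γ Mg n * √(Real.log (Real.exp (1 / 4) / δ))} := by
  have hn' : (0 : ℝ) < n := Nat.cast_pos.2 hn
  have h2 : 0 < 1 - M.γ := by linarith [M.γ_lt_one]
  set L := Real.log (Real.exp (1 / 4) / δ) with hL
  have hLeq : L = 1 / 4 - Real.log δ := by
    rw [hL, Real.log_div (Real.exp_pos _).ne' hδ.ne', Real.log_exp]
  have hL4 : 1 / 4 ≤ L := by
    rw [hLeq]; linarith [Real.log_nonpos hδ.le hδ1.le]
  set σ := Mg / (1 - M.γ) ^ (3 / 2 : ℝ) with hσ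
  have hσ0 : 0 < σ := by positivity
  have hm := M.measurable_trajGrad hπ hU hθ i (H := H)
  -- With y = 8L the bound exp(1/4 - y/8) equals δ. The condition y ≥ 2 follows from δ < 1, and y ≤
  -- n is the sample size assumption.
  have htail := measureReal_norm_sum_sub_integral_le (y := 8 * L) (σ := σ)
    (X := fun j ω => M.trajGrad π i θ (τ j ω))
    (hind.comp (fun _ => M.trajGrad π i θ) fun _ => hm)
    (fun j => hm.comp_aemeasurable (hτ j).aemeasurable)
    (fun j ω => M.norm_trajGrad_le hπ hθ i _) hσ0
    (fun j => by
      have h := (hτ j).integral_comp hm.aestronglyMeasurable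
      simp only [Function.comp_apply] at h
      rw [h]
      exact M.norm_integral_trajGrad_le hMg hπ hU hθ i H)
    (fun j c hc => by
      have h := (hτ j).integral_comp (f := fun x => Real.cosh (c * ‖M.trajGrad π i θ x‖))
        (Real.measurable_cosh.comp (hm.norm.const_mul c)).aestronglyMeasurable
      simp only [Function.comp_apply] at h
      rw [h]
      exact M.integral_cosh_trajGrad_le hMg hπ hU hθ i H hc)
    (by linarith) hnδ
  have hδeq : Real.exp (1 / 4 - 8 * L / 8) = δ := by
    rw [hLeq, show 1 / 4 - 8 * (1 / 4 - Real.log δ) / 8 = Real.log δ by ring, Real.exp_log hδ]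
  rw [hδeq] at htail
  refine one_sub_le_measureReal htail fun ω hω => ?_
  have hω' : scaleGrad M.γ Mg n * √L < ‖M.gradEst π i θ (fun j => τ j ω)
      - ∫ ω', M.gradEst π i θ (fun j => τ j ω') ∂Pr‖ := not_le.1 hω
  simp_rw [gradEst_eq] at hω'
  rw [integral_smul, integral_finsetSum _ fun j _ => M.integrable_trajGrad hπ hU hθ hτ i j,
    ← smul_sub, ← Finset.sum_sub_distrib, norm_smul, Real.norm_of_nonneg (by positivity),
    one_div, ← div_eq_inv_mul, lt_div_iff₀ hn'] at hω'
  refine le_trans (le_of_eq ?_) hω'.le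
  have h8 : √(n * (8 * L)) = 2 * √2 * √n * √L := by
    rw [show (n : ℝ) * (8 * L) = 2 ^ 2 * 2 * n * L by ring, Real.sqrt_mul (by positivity),
      Real.sqrt_mul (by positivity), Real.sqrt_mul (by positivity), Real.sqrt_sq two_pos.le]
  rw [h8, scaleGrad, hσ]
  nth_rewrite 3 [← Real.mul_self_sqrt hn'.le]
  have : 0 < √(n : ℝ) := by positivity
  field_simp

end CMDP

end

theorem mainTheorem7 {S A : Type*} [MeasurableSpace S] [MeasurableSpace A] {m d : ℕ}
    {ν : Measure A} [SFinite ν] (M : CMDP S A m) (π : PolicyFamily S A d ν)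
    (U : Set (EuclideanSpace ℝ (Fin d))) (hU : IsOpen U)
    (Mg Mh : ℝ) (hMg : 0 < Mg) (hMh : 0 < Mh) (hπ : π.BoundedScore U Mg Mh)
    (i : Fin (m + 1)) :
    -- Lipschitz continuity and smoothness of the value functions
    ((∀ θ ∈ U, DifferentiableAt ℝ (M.value π i) θ) ∧
      ∀ X : Set (EuclideanSpace ℝ (Fin d)), convexHull ℝ X ⊆ U →
        LipschitzContOn (M.value π i) (Mg / (1 - M.γ) ^ 2) X ∧
        MSmoothOn (M.value π i) ((Mg ^ 2 + Mh) / (1 - M.γ) ^ 2) X) ∧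
    -- the estimators, from `n` independent trajectories of horizon `H` sampled under `π_θ`
    ∀ θ ∈ U, ∀ (n H : ℕ), 0 < n →
      ∀ {Ω : Type*} [MeasurableSpace Ω] (Pr : Measure Ω) [IsProbabilityMeasure Pr]
        (τ : Fin n → Ω → (Fin H → S × A)),
        iIndepFun τ Pr → (∀ j, HasLaw (τ j) (M.truncLaw π θ H) Pr) →
        -- bias bounds
        (Integrable (fun ω => M.valueEst i (fun j => τ j ω)) Pr ∧
          |M.value π i θ - ∫ ω, M.valueEst i (fun j => τ j ω) ∂Pr| ≤ biasValue M.γ H) ∧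
        (Integrable (fun ω => M.gradEst π i θ (fun j => τ j ω)) Pr ∧
          ‖gradient (M.value π i) θ - ∫ ω, M.gradEst π i θ (fun j => τ j ω) ∂Pr‖
            ≤ biasGrad M.γ Mg H) ∧
        -- sub-Gaussian tail bounds
        ∀ δ : ℝ, 0 < δ → δ < 1 →
          1 - δ ≤ Pr.real {ω | |M.valueEst i (fun j => τ j ω)
              - ∫ ω', M.valueEst i (fun j => τ j ω') ∂Pr|
            ≤ scaleValue M.γ n * √(Real.log (2 / δ))} ∧
          (8 * Real.log (Real.exp (1 / 4) / δ) ≤ n →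
            1 - δ ≤ Pr.real {ω | ‖M.gradEst π i θ (fun j => τ j ω)
                - ∫ ω', M.gradEst π i θ (fun j => τ j ω') ∂Pr‖
              ≤ scaleGrad M.γ Mg n * √(Real.log (Real.exp (1 / 4) / δ))})
    := by
  refine ⟨⟨fun θ hθ => (M.hasGradientAt_value hMg hπ hU hθ i).differentiableAt,
    fun X hX => ⟨M.lipschitzContOn_value hMg hπ hU i hX, M.mSmoothOn_value hMg hπ hU i hX⟩⟩, ?_⟩
  intro θ hθ n H hn Ω _ Pr _ τ hind hτ
  refine ⟨⟨?_, ?_⟩, ⟨?_, ?_⟩, fun δ hδ hδ1 =>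
    ⟨M.valueEst_tail hn hind hτ i hδ hδ1, M.gradEst_tail hMg hπ hU hθ hn hind hτ i hδ hδ1⟩⟩
  · exact (integrable_finsetSum _ fun j _ => M.integrable_trajValue hτ i j).const_mul _
  · rw [M.integral_valueEst hn hτ]
    exact M.bias_value_le π θ i H
  · exact (integrable_finsetSum _ fun j _ =>
      M.integrable_trajGrad hπ hU hθ hτ i j).fun_smul (1 / (n : ℝ))
  · rw [M.integral_gradEst hn hπ hU hθ hτ]
    exact M.bias_grad_le hMg hπ hU hθ i H
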